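/- For integers $n\ge 0$ and $k$ let $p_{n,k}(x)=\binom nk x^k(1-x)^{n-k}$ if $0\le k\le n$ and $p_{n,k}=0$ otherwise. For an integer $n\ge 4$ and real $x$ put $$\beta(x,n)=\tfrac{n^2}{2}x^4-(n^2+2n+2)x^3+\Big(5+\tfrac{10}{3}n+\tfrac{n^2}{2}\Big)x^2-\Big(4+\tfrac43 n\Big)x+1,$$ $$\gamma(x,n)=-2n^2x^4+(4n^2+4n+4)x^3-\Big(2n^2+\tfrac{19}{3}n+8\Big)x^2+\Big(4+\tfrac73 n\Big)x,\qquad \delta(x,n)=3n^2x^2(1-x)^2,$$ $$\tilde p^{\,3}_{n,k}(x)=\beta(x,n)p_{n-4,k}(x)+\gamma(x,n)p_{n-4,k-1}(x)+\delta(x,n)p_{n-4,k-2}(x)+\gamma(1-x,n)p_{n-4,k-3}(x)+\beta(1-x,n)p_{n-4,k-4}(x),$$ and, for $f$ continuous on $[0,1]$ and $x\in[0,1]$, let $$\tilde U_n^3(f;x)=(n-1)\sum_{k=1}^{n-1}\tilde p^{\,3}_{n,k}(x)\int_0^1p_{n-2,k-1}(t)f(t)\,dt+\beta(x,n)(1-x)^{n-4}f(0)+\beta(1-x,n)x^{n-4}f(1).$$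 Let $\tilde\mu^3_{n,k}(x)=\tilde U_n^3((t-x)^k;x)$ be its central moments. Below, $O(n^{-r})$ denotes a quantity $E_n(x)$ for which there is a constant $C$, independent of $n$ and $x$, such that $|E_n(x)|\le C n^{-r}$ for all integers $n\ge4$ and all $x\in[0,1]$. Then, for $n\ge 4$ and $x\in[0,1]$: (i) $\tilde\mu^3_{n,1}(x)=\tilde\mu^3_{n,2}(x)=\tilde\mu^3_{n,3}(x)=0$; (ii) $\tilde\mu^3_{n,4}(x)=\dfrac{4x(1-x)(39x^2-39x+10)}{\prod_{k=1}^3(n+k)}+O(n^{-4})$; (iii) $\tilde\mu^3_{n,5}(x)=\dfrac{120(1-2x)x^2(1-x)^2n}{\prod_{k=1}^4(n+k)}+O(n^{-4})$; (iv) $\tilde\mu^3_{n,6}(x)=\dfrac{120x^3(1-x)^3n^2}{\prod_{k=1}^5(n+k)}+O(n^{-4})$; (v) $\tilde\mu^3_{n,7}(x)=O(n^{-4})$ and $\tilde\mu^3_{n,8}(x)=O(n^{-4})$; (vi) $\tilde\mu^3_{n,9}(x)=O(n^{-5})$ and $\tilde\mu^3_{n,10}(x)=O(n^{-5})$; (vii)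 for every $f\in C^{10}[0,1]$, $\tilde U_n^3(f;x)-f(x)=O(n^{-3})$, with a constant that may depend on $f$. -/

import Mathlib

namespace GenuineBD

noncomputable section

/-- The Bernstein fundamental polynomial `p_{n,k}(x) = C(n,k) x^k (1-x)^(n-k)`, with the usual
convention that it vanishes for an integer index `k` outside `{0, …, n}` (for `k > n` the
binomial coefficient is zero). -/
def p (n : ℕ) (k : ℤ) (x : ℝ) : ℝ :=
  if 0 ≤ k then (bernsteinPolynomial ℝ n k.toNat).eval x else 0

/-- The modified fundamental functions `p^3_{n,k}(x)` built from coefficient functions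
`β = β(·,n)`, `γ = γ(·,n)`, `δ = δ(·,n)`, for `n ≥ 4`. -/
def p3 (β γ δ : ℝ → ℝ) (n : ℕ) (k : ℤ) (x : ℝ) : ℝ :=
  β x * p (n - 4) k x + γ x * p (n - 4) (k - 1) x + δ x * p (n - 4) (k - 2) x
    + γ (1 - x) * p (n - 4) (k - 3) x + β (1 - x) * p (n - 4) (k - 4) x

/-- The operator `U_n^3` with coefficient functions `β`, `γ`, `δ`, for `n ≥ 4`. -/
def U3 (β γ δ : ℝ → ℝ) (n : ℕ) (f : ℝ → ℝ) (x : ℝ) : ℝ :=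
  ((n : ℝ) - 1) * (∑ k ∈ Finset.Icc 1 (n - 1),
      p3 β γ δ n (k : ℤ) x * (∫ t in (0 : ℝ)..1, p (n - 2) ((k : ℤ) - 1) t * f t))
    + β x * (1 - x) ^ (n - 4) * f 0 + β (1 - x) * x ^ (n - 4) * f 1

/-- The specific coefficient `β(x,n)`. -/
def tildeBeta (n : ℕ) (x : ℝ) : ℝ :=
  (1 / 2 * (n : ℝ) ^ 2) * x ^ 4 + (-(n : ℝ) ^ 2 - 2 * n - 2) * x ^ 3
    + (5 + 10 / 3 * (n : ℝ) + 1 / 2 * (n : ℝ) ^ 2) * x ^ 2 + (-4 - 4 / 3 * (n : ℝ)) * x + 1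

/-- The specific coefficient `γ(x,n)`. -/
def tildeGamma (n : ℕ) (x : ℝ) : ℝ :=
  (-2 * (n : ℝ) ^ 2) * x ^ 4 + (4 * (n : ℝ) ^ 2 + 4 * n + 4) * x ^ 3
    + (-(19 / 3) * (n : ℝ) - 2 * (n : ℝ) ^ 2 - 8) * x ^ 2 + (4 + 7 / 3 * (n : ℝ)) * x

/-- The specific coefficient `δ(x,n)`. -/
def tildeDelta (n : ℕ) (x : ℝ) : ℝ :=
  3 * (n : ℝ) ^ 2 * (x * (1 - x)) ^ 2

/-- The modified genuine Bernstein-Durrmeyer operator `Ũ_n^3`, for `n ≥ 4`. -/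
def tildeU3 (n : ℕ) (f : ℝ → ℝ) (x : ℝ) : ℝ :=
  U3 (tildeBeta n) (tildeGamma n) (tildeDelta n) n f x

/-- The central moment `μ̃^3_{n,k}(x) = Ũ_n^3((t - x)^k; x)`. -/
def tildeMu3 (n k : ℕ) (x : ℝ) : ℝ :=
  tildeU3 n (fun t => (t - x) ^ k) x

end

end GenuineBD

/-! Put m = n - 4. The operator is a sum, with weights `coeff`, of five Bernstein averages of the
functionals `node n (k + i)`, i = 0, ..., 4 (`tildeU3_eq`). Each functional is an endpoint
evaluation or a Beta integral, and all their central moments obey one three-term recursion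
(`node_sub_pow`). Averaging it against p_{m,k}, with the factor k - mx traded for a derivative in x,
writes the averaged moment of order r as a polynomial `momentNum` over n(n+1)...(n+r-1)
(`bernMoment_eq`).

The numerators consist of terms n^a i^b g(x) with 2a + b ≤ r. The weights have size n^2, but their
n^2 part is a multiple of the fourth difference (1, -4, 6, -4, 1), and further cancellation makes ∑
coeff_i i^b only O(n^⌊b/2⌋) (`abs_sum_coeff_mul_pow_le`). Hence the moment of order r is
O(n^{-⌈r/2⌉}), which settles orders 7 to 10; orders 1 to 6 need the explicit numerators.

For f in C^10, the Taylor polynomial of degree 9 contributes f(x) and moments of size O(n^{-3}). The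
remainder is at most a multiple of (t-x)^10; since the functionals are positive, it costs n^2 from
the weights times n^{-5} from the tenth moments. -/

namespace GenuineBD

open Polynomial

/-! ### Bernstein polynomials: derivatives and integrals. -/

/-- The Bernstein fundamental polynomial with natural index. -/
noncomputable def bern (m k : ℕ) (x : ℝ) : ℝ := (bernsteinPolynomial ℝ m k).eval x

lemma bern_eq (m k : ℕ) (x : ℝ) : bern m k x = m.choose k * x ^ k * (1 - x) ^ (m - k) := by
  simp [bern, bernsteinPolynomial]

lemma bern_nonneg (m k : ℕ) {x : ℝ} (hx : x ∈ Set.Icc (0 : ℝ) 1) : 0 ≤ bern m k x := by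
  have h0 := hx.1
  have h1 : 0 ≤ 1 - x := by linarith [hx.2]
  rw [bern_eq]; positivity

lemma continuous_bern (m k : ℕ) : Continuous (bern m k) :=
  (bernsteinPolynomial ℝ m k).continuous

/-- The derivative of a Bernstein polynomial. -/
noncomputable def bernDeriv (m k : ℕ) (x : ℝ) : ℝ :=
  (derivative (bernsteinPolynomial ℝ m k)).eval x

lemma hasDerivAt_bern (m k : ℕ) (x : ℝ) : HasDerivAt (bern m k) (bernDeriv m k x) x :=
  (bernsteinPolynomial ℝ m k).hasDerivAt x

lemma continuous_bernDeriv (m k : ℕ) : Continuous (bernDeriv m k) :=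
  (derivative (bernsteinPolynomial ℝ m k)).continuous

/-- Logarithmic derivative of x^k (1-x)^(m-k), with denominators cleared. -/
lemma mul_bernDeriv {m k : ℕ} (hk : k ≤ m) (x : ℝ) :
    x * (1 - x) * bernDeriv m k x = (k - m * x) * bern m k x := by
  obtain ⟨l, rfl⟩ := Nat.exists_eq_add_of_le hk
  have h1 : x * (k * x ^ (k - 1)) = k * x ^ k := by
    cases k with
    | zero => simp
    | succ k => simp only [Nat.add_sub_cancel]; ring
  have h2 : (1 - x) * (l * (1 - x) ^ (l - 1)) = l * (1 - x) ^ l := by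
    cases l with
    | zero => simp
    | succ k => simp only [Nat.add_sub_cancel]; ring
  have h3 : bernDeriv (k + l) k x = (k + l).choose k *
      (k * x ^ (k - 1) * (1 - x) ^ l - x ^ k * (l * (1 - x) ^ (l - 1))) := by
    simp [bernDeriv, bernsteinPolynomial, derivative_pow]
    ring
  rw [h3, bern_eq, Nat.add_sub_cancel_left]
  push_cast
  linear_combination ((k + l).choose k : ℝ) * (1 - x) * (1 - x) ^ l * h1
    - ((k + l).choose k : ℝ) * x * x ^ k * h2

lemma sum_bern (m : ℕ) (x : ℝ) : ∑ k ∈ Finset.range (m + 1), bern m k x = 1 := by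
  have h := congrArg (eval x) (bernsteinPolynomial.sum ℝ m)
  simpa [eval_finsetSum, bern] using h

lemma integral_bernDeriv (m k : ℕ) :
    ∫ t in (0 : ℝ)..1, bernDeriv m k t = bern m k 1 - bern m k 0 :=
  intervalIntegral.integral_eq_sub_of_hasDerivAt (fun t _ => hasDerivAt_bern m k t)
    ((continuous_bernDeriv m k).intervalIntegrable _ _)

/-- Integrating the derivative of p_{m+1,j+1} shows that p_{m,j} and p_{m,j+1} have equal integrals
for j < m. At j = m the second vanishes and the boundary term is 1, so the value propagates downward
from k = m. -/
lemma succ_mul_integral_bern {m k : ℕ} (hk : k ≤ m) :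
    ((m : ℝ) + 1) * ∫ t in (0 : ℝ)..1, bern m k t = 1 := by
  have key : ∀ j : ℕ, ((m : ℝ) + 1) * ((∫ t in (0 : ℝ)..1, bern m j t)
      - ∫ t in (0 : ℝ)..1, bern m (j + 1) t) = if j = m then 1 else 0 := by
    intro j
    rw [← intervalIntegral.integral_sub ((continuous_bern m j).intervalIntegrable _ _)
      ((continuous_bern m (j + 1)).intervalIntegrable _ _), ← intervalIntegral.integral_const_mul]
    have : ∀ t, ((m : ℝ) + 1) * (bern m j t - bern m (j + 1) t) = bernDeriv (m + 1) (j + 1) t := by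
      intro t
      simp [bernDeriv, bernsteinPolynomial.derivative_succ, bern]
    simp only [this, integral_bernDeriv]
    simp [bern, bernsteinPolynomial.eval_at_0, bernsteinPolynomial.eval_at_1]
  induction hk using Nat.decreasingInduction with
  | self =>
    have h := key m
    have h0 : ∀ t, bern m (m + 1) t = 0 := fun t => by simp [bern_eq]
    simpa [h0] using h
  | of_succ k hk ih =>
    have h := key k
    rw [if_neg (by omega)] at h
    linarith

/-! ### The node functionals and their central moments. -/

/-- The functionals out of which the genuine Bernstein-Durrmeyer operators are built. -/
noncomputable def node (n k : ℕ) (f : ℝ → ℝ) : ℝ :=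
  if k = 0 then f 0 else if k = n then f 1
  else ((n : ℝ) - 1) * ∫ t in (0 : ℝ)..1, bern (n - 2) (k - 1) t * f t

lemma node_mono {n k : ℕ} (hn : 1 ≤ n) {f g : ℝ → ℝ} (hf : ContinuousOn f (Set.Icc 0 1))
    (hg : ContinuousOn g (Set.Icc 0 1)) (h : ∀ t ∈ Set.Icc (0 : ℝ) 1, f t ≤ g t) :
    node n k f ≤ node n k g := by
  unfold node
  have hn' : (0 : ℝ) ≤ n - 1 := by
    have : (1 : ℝ) ≤ n := by exact_mod_cast hn
    linarith
  split_ifs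
  · exact h 0 (by simp)
  · exact h 1 (by simp)
  · refine mul_le_mul_of_nonneg_left ?_ hn'
    refine intervalIntegral.integral_mono_on zero_le_one ?_ ?_ fun t ht =>
      mul_le_mul_of_nonneg_left (h t ht) (bern_nonneg _ _ ht)
    · exact ((continuous_bern _ _).continuousOn.mul
        (by rwa [Set.uIcc_of_le zero_le_one])).intervalIntegrable
    · exact ((continuous_bern _ _).continuousOn.mul
        (by rwa [Set.uIcc_of_le zero_le_one])).intervalIntegrable

lemma node_add {n k : ℕ} {f g : ℝ → ℝ} (hf : ContinuousOn f (Set.Icc 0 1))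
    (hg : ContinuousOn g (Set.Icc 0 1)) :
    node n k (fun t => f t + g t) = node n k f + node n k g := by
  unfold node
  split_ifs
  · rfl
  · rfl
  · rw [← mul_add, ← intervalIntegral.integral_add]
    · simp only [mul_add]
    · exact ((continuous_bern _ _).continuousOn.mul
        (by rwa [Set.uIcc_of_le zero_le_one])).intervalIntegrable
    · exact ((continuous_bern _ _).continuousOn.mul
        (by rwa [Set.uIcc_of_le zero_le_one])).intervalIntegrable

lemma node_const_mul (n k : ℕ) (c : ℝ) (f : ℝ → ℝ) :
    node n k (fun t => c * f t) = c * node n k f := by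
  unfold node
  split_ifs
  · rfl
  · rfl
  · simp only [mul_left_comm _ c, intervalIntegral.integral_const_mul]

/-- The central moments of the functionals `node n k`, by recursion. -/
noncomputable def nodeMoment (n k x : ℝ) : ℕ → ℝ
  | 0 => 1
  | 1 => (k - n * x) / n
  | r + 2 => ((r + 1) * (x * (1 - x)) * nodeMoment n k x r
      + ((r + 1) * (1 - 2 * x) + (k - n * x)) * nodeMoment n k x (r + 1)) / (n + r + 1)

lemma mul_nodeMoment_one {n : ℝ} (hn : 0 < n) (k x : ℝ) :
    n * nodeMoment n k x 1 = k - n * x := by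
  rw [nodeMoment]; field_simp

lemma mul_nodeMoment_add_two {n : ℝ} (hn : 0 < n) (k x : ℝ) (r : ℕ) :
    (n + r + 1) * nodeMoment n k x (r + 2) = (r + 1) * (x * (1 - x)) * nodeMoment n k x r
      + ((r + 1) * (1 - 2 * x) + (k - n * x)) * nodeMoment n k x (r + 1) := by
  have : n + r + 1 ≠ 0 := by positivity
  rw [nodeMoment]; field_simp

/-- Uniqueness for the recursion: endpoint evaluations and Beta integrals are identified by checking
the same three conditions. -/
lemma eq_nodeMoment {n : ℝ} (hn : 0 < n) {k x : ℝ} {u : ℕ → ℝ} (h0 : u 0 = 1)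
    (h1 : n * u 1 = k - n * x)
    (h2 : ∀ r : ℕ, (n + r + 1) * u (r + 2) = (r + 1) * (x * (1 - x)) * u r
      + ((r + 1) * (1 - 2 * x) + (k - n * x)) * u (r + 1)) (r : ℕ) :
    u r = nodeMoment n k x r := by
  induction r using Nat.twoStepInduction with
  | zero => rw [h0, nodeMoment]
  | one => exact mul_left_cancel₀ hn.ne' (h1.trans (mul_nodeMoment_one hn k x).symm)
  | more r ih0 ih1 =>
    have : n + r + 1 ≠ 0 := by positivity
    refine mul_left_cancel₀ this ?_
    rw [h2, mul_nodeMoment_add_two hn, ih0, ih1]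

/-- The integrand is the derivative of t(1-t) p_{N,j}(t) (t-x)^r, which vanishes at both endpoints.
-/
lemma integral_bern_by_parts {N j : ℕ} (hj : j ≤ N) (x : ℝ) (r : ℕ) :
    ∫ t in (0 : ℝ)..1, bern N j t * (((j + 1) - (N + 2) * t) * (t - x) ^ r
      + t * (1 - t) * (r * (t - x) ^ (r - 1))) = 0 := by
  have hd : ∀ t : ℝ, HasDerivAt (fun t => (t * (1 - t)) * bern N j t * (t - x) ^ r)
      (bern N j t * (((j + 1) - (N + 2) * t) * (t - x) ^ r
      + t * (1 - t) * (r * (t - x) ^ (r - 1)))) t := by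
    intro t
    have h := (((hasDerivAt_id t).mul ((hasDerivAt_id t).const_sub 1)).mul
      (hasDerivAt_bern N j t)).mul (((hasDerivAt_id t).sub_const x).pow r)
    refine h.congr_deriv ?_
    simp only [id, Pi.mul_apply, Pi.pow_apply]
    linear_combination (t - x) ^ r * mul_bernDeriv hj t
  have hc := continuous_bern N j
  rw [intervalIntegral.integral_eq_sub_of_hasDerivAt (fun t _ => hd t)
    (Continuous.intervalIntegrable (by fun_prop) _ _)]
  simp

lemma node_sub_pow {n k : ℕ} (hn : 2 ≤ n) (hk : k ≤ n) (x : ℝ) (r : ℕ) :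
    node n k (fun t => (t - x) ^ r) = nodeMoment n k x r := by
  have hn0 : (0 : ℝ) < n := by positivity
  rcases Nat.eq_zero_or_pos k with rfl | hk0
  · refine eq_nodeMoment (u := fun r => node n 0 (fun t => (t - x) ^ r)) hn0 ?_ ?_ ?_ r
    · simp [node]
    · simp [node]
    · intro r; simp only [node, if_true]; push_cast; ring
  rcases hk.eq_or_lt with rfl | hkn
  · refine eq_nodeMoment (u := fun r => node k k (fun t => (t - x) ^ r)) hn0 ?_ ?_ ?_ r
    · simp [node]
    · simp [node, hk0.ne']; ring
    · intro r; simp only [node, hk0.ne', if_true, if_false]; ring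
  obtain ⟨j, rfl⟩ : ∃ j, k = j + 1 := ⟨k - 1, by omega⟩
  obtain ⟨N, rfl⟩ : ∃ N, n = N + 2 := ⟨n - 2, by omega⟩
  have hj : j ≤ N := by omega
  have hc := continuous_bern N j
  set J : ℕ → ℝ := fun r => ((N : ℝ) + 1) * ∫ t in (0 : ℝ)..1, bern N j t * (t - x) ^ r with hJ
  have hu : ∀ r, node (N + 2) (j + 1) (fun t => (t - x) ^ r) = J r := by
    intro r
    have : j + 1 ≠ N + 2 := by omega
    simp only [node, this, if_false, hJ, Nat.add_sub_cancel, Nat.succ_ne_zero]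
    push_cast
    ring
  have hint : ∀ r, IntervalIntegrable (fun t => bern N j t * (t - x) ^ r) MeasureTheory.volume 0 1 :=
    fun r => Continuous.intervalIntegrable (by fun_prop) _ _
  rw [hu]
  refine eq_nodeMoment hn0 ?_ ?_ ?_ r
  · simpa [hJ] using succ_mul_integral_bern hj
  · have h := integral_bern_by_parts hj x 0
    have h' := succ_mul_integral_bern hj
    have e : ∀ t : ℝ, bern N j t * (((j + 1) - (N + 2) * t) * (t - x) ^ 0
      + t * (1 - t) * ((0 : ℕ) * (t - x) ^ (0 - 1)))
      = ((j + 1) - (N + 2) * x) * (bern N j t * (t - x) ^ 0)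
        - (N + 2) * (bern N j t * (t - x) ^ 1) := by
      intro t; push_cast; ring
    simp only [e] at h
    rw [intervalIntegral.integral_sub ((hint 0).const_mul _) ((hint 1).const_mul _),
      intervalIntegral.integral_const_mul, intervalIntegral.integral_const_mul] at h
    simp only [pow_zero, mul_one] at h
    simp only [hJ]
    push_cast
    linear_combination -((N : ℝ) + 1) * h + ((j + 1) - (N + 2) * x) * h'
  · intro r
    have h := integral_bern_by_parts hj x (r + 1)
    -- Expansion about x, using t(1-t) = x(1-x) + (1-2x)(t-x) - (t-x)^2.
    have e : ∀ t : ℝ, bern N j t * (((j + 1) - (N + 2) * t) * (t - x) ^ (r + 1)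
      + t * (1 - t) * ((r + 1 : ℕ) * (t - x) ^ (r + 1 - 1)))
      = ((r + 1) * (x * (1 - x))) * (bern N j t * (t - x) ^ r)
        + ((r + 1) * (1 - 2 * x) + ((j + 1) - (N + 2) * x)) * (bern N j t * (t - x) ^ (r + 1))
        - (N + 2 + r + 1) * (bern N j t * (t - x) ^ (r + 2)) := by
      intro t; rw [Nat.add_sub_cancel]; push_cast; ring
    simp only [e] at h
    rw [intervalIntegral.integral_sub (((hint _).const_mul _).add ((hint _).const_mul _))
      ((hint _).const_mul _), intervalIntegral.integral_add ((hint _).const_mul _)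
      ((hint _).const_mul _),
      intervalIntegral.integral_const_mul, intervalIntegral.integral_const_mul,
      intervalIntegral.integral_const_mul] at h
    simp only [hJ]
    push_cast
    linear_combination -((N : ℝ) + 1) * h

/-- This is the rule for differentiating (t-x)^(r+1) in x. For real n and k no functional is at
hand, so it is derived by differentiating the recursion. -/
lemma hasDerivAt_nodeMoment {n : ℝ} (hn : 0 < n) (k x : ℝ) (r : ℕ) :
    HasDerivAt (fun x => nodeMoment n k x (r + 1)) (-(r + 1) * nodeMoment n k x r) x := by
  have h0 : ∀ x, HasDerivAt (fun x => nodeMoment n k x 0) 0 x := by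
    intro x; simp only [nodeMoment]; exact hasDerivAt_const _ _
  have h1 : ∀ x, HasDerivAt (fun x => nodeMoment n k x 1) (-1) x := by
    intro x; simp only [nodeMoment]
    have := ((((hasDerivAt_id x).const_mul n).const_sub k).div_const n)
    refine this.congr_deriv ?_
    field_simp
  have step : ∀ (r : ℕ) (a b : ℝ) (x : ℝ), HasDerivAt (fun x => nodeMoment n k x r) a x →
      HasDerivAt (fun x => nodeMoment n k x (r + 1)) b x →
      HasDerivAt (fun x => nodeMoment n k x (r + 2))
      (((r + 1) * (1 - 2 * x) * nodeMoment n k x r + (r + 1) * (x * (1 - x)) * a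
        - (2 * (r + 1) + n) * nodeMoment n k x (r + 1)
        + ((r + 1) * (1 - 2 * x) + (k - n * x)) * b) / (n + r + 1)) x := by
    intro r a b x ha hb
    simp only [nodeMoment]
    have hX := (((hasDerivAt_id x).mul ((hasDerivAt_id x).const_sub 1)).const_mul
      ((r : ℝ) + 1)).mul ha
    have hY := (((((hasDerivAt_id x).const_mul 2).const_sub 1).const_mul ((r : ℝ) + 1)).add
      (((hasDerivAt_id x).const_mul n).const_sub k)).mul hb
    refine ((hX.add hY).div_const _).congr_deriv ?_
    simp only [id, Pi.mul_apply, Pi.add_apply]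
    ring
  induction r using Nat.twoStepInduction with
  | zero => simpa [nodeMoment] using h1 x
  | one =>
    have : n + ((0 : ℕ) : ℝ) + 1 ≠ 0 := by push_cast; linarith
    refine (step 0 _ _ x (h0 x) (h1 x)).congr_deriv ?_
    rw [div_eq_iff this]
    have e := mul_nodeMoment_one hn k x
    simp only [zero_add, nodeMoment.eq_1]
    push_cast
    linear_combination e
  | more r ih0 ih1 =>
    have : n + ((r + 1 : ℕ) : ℝ) + 1 ≠ 0 := by positivity
    refine (step (r + 1) _ _ x ih0 ih1).congr_deriv ?_
    rw [div_eq_iff this]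
    have e := mul_nodeMoment_add_two hn k x r
    push_cast
    linear_combination (r + 2) * e

/-! ### Bernstein averages of the moments and their polynomial numerators. -/

/-- Bernstein average of the shifted central moments of the node functionals. -/
noncomputable def bernMoment (m : ℕ) (i x : ℝ) (r : ℕ) : ℝ :=
  ∑ k ∈ Finset.range (m + 1), bern m k x * nodeMoment (m + 4) (k + i) x r

lemma bernMoment_zero (m : ℕ) (i x : ℝ) : bernMoment m i x 0 = 1 := by
  simp [bernMoment, nodeMoment, sum_bern]

/-- The derivative part of `bernMoment` coming from the Bernstein polynomials. -/
noncomputable def bernMomentAux (m : ℕ) (i x : ℝ) (r : ℕ) : ℝ :=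
  ∑ k ∈ Finset.range (m + 1), bernDeriv m k x * nodeMoment (m + 4) (k + i) x r

lemma hasDerivAt_bernMoment_zero (m : ℕ) (i x : ℝ) :
    HasDerivAt (fun x => bernMoment m i x 0) (bernMomentAux m i x 0) x := by
  unfold bernMoment bernMomentAux
  simp only [nodeMoment, mul_one]
  exact HasDerivAt.fun_sum fun k _ => hasDerivAt_bern m k x

lemma hasDerivAt_bernMoment_succ (m : ℕ) (i x : ℝ) (r : ℕ) :
    HasDerivAt (fun x => bernMoment m i x (r + 1))
      (bernMomentAux m i x (r + 1) - (r + 1) * bernMoment m i x r) x := by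
  have hn : (0 : ℝ) < m + 4 := by positivity
  have h := HasDerivAt.fun_sum (u := Finset.range (m + 1)) fun k _ =>
    (hasDerivAt_bern m k x).fun_mul (hasDerivAt_nodeMoment hn (k + i) x r)
  refine h.congr_deriv ?_
  rw [bernMomentAux, bernMoment, Finset.mul_sum, ← Finset.sum_sub_distrib]
  exact Finset.sum_congr rfl fun k _ => by ring

lemma mul_bernMomentAux (m : ℕ) (i x : ℝ) (r : ℕ) :
    x * (1 - x) * bernMomentAux m i x r
      = ∑ k ∈ Finset.range (m + 1), (k - m * x) * bern m k x * nodeMoment (m + 4) (k + i) x r := by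
  rw [bernMomentAux, Finset.mul_sum]
  refine Finset.sum_congr rfl fun k hk => ?_
  rw [← mul_assoc, mul_bernDeriv (Nat.lt_succ_iff.mp (Finset.mem_range.mp hk))]

/-- Split k + i - (m+4)x as (k - mx) + (i - 4x). The first part averages to zero, being x(1-x) times
the derivative of the constant ∑ p_{m,k} = 1. -/
lemma mul_bernMoment_one (m : ℕ) (i x : ℝ) :
    (m + 4) * bernMoment m i x 1 = i - 4 * x := by
  have hn : (0 : ℝ) < m + 4 := by positivity
  have h0 : bernMomentAux m i x 0 = 0 := by
    refine (hasDerivAt_bernMoment_zero m i x).unique ?_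
    simp only [bernMoment_zero]
    exact hasDerivAt_const _ _
  have h1 := mul_bernMomentAux m i x 0
  have h2 := bernMoment_zero m i x
  rw [bernMoment] at h2
  rw [h0, mul_zero] at h1
  rw [← mul_one (i - 4 * x), ← h2, ← add_zero ((i - 4 * x) * _), h1, bernMoment, Finset.mul_sum,
    Finset.mul_sum, ← Finset.sum_add_distrib]
  refine Finset.sum_congr rfl fun k _ => ?_
  rw [nodeMoment.eq_1]
  linear_combination bern m k x * mul_nodeMoment_one hn (k + i) x

lemma mul_bernMoment_add_two (m : ℕ) (i x : ℝ) (r : ℕ) :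
    (m + 4 + r + 1) * bernMoment m i x (r + 2)
      = (r + 1) * (x * (1 - x)) * bernMoment m i x r
        + ((r + 1) * (1 - 2 * x) + (i - 4 * x)) * bernMoment m i x (r + 1)
        + x * (1 - x) * bernMomentAux m i x (r + 1) := by
  have hn : (0 : ℝ) < m + 4 := by positivity
  rw [mul_bernMomentAux]
  simp only [bernMoment, Finset.mul_sum, ← Finset.sum_add_distrib]
  refine Finset.sum_congr rfl fun k _ => ?_
  linear_combination bern m k x * mul_nodeMoment_add_two hn (k + i) x r

/-- The numerators of `bernMoment`, as polynomials in `x`. -/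
noncomputable def momentNum (n i : ℝ) : ℕ → ℝ[X]
  | 0 => 1
  | 1 => C i - C 4 * X
  | r + 2 => C (2 * (r + 1) * (n + r)) * (X * (1 - X)) * momentNum n i r
      + (C ((r : ℝ) + 1) * (1 - C 2 * X) + (C i - C 4 * X)) * momentNum n i (r + 1)
      + X * (1 - X) * derivative (momentNum n i (r + 1))

/-- The derivative falling on the Bernstein weights equals the derivative of the whole average plus
(r+1) times the previous one. This doubles the coefficient r+1 of the recursion, whence the
2(r+1)(n+r) in `momentNum`. -/
lemma bernMoment_eq (m : ℕ) (i : ℝ) (r : ℕ) (x : ℝ) :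
    (∏ j ∈ Finset.range r, ((m : ℝ) + 4 + j)) * bernMoment m i x r
      = (momentNum (m + 4) i r).eval x := by
  have hpos : ∀ r : ℕ, (∏ j ∈ Finset.range r, ((m : ℝ) + 4 + j)) ≠ 0 := fun r =>
    Finset.prod_ne_zero_iff.mpr fun j _ => by positivity
  induction r using Nat.twoStepInduction generalizing x with
  | zero => simp [bernMoment_zero, momentNum]
  | one => simpa [momentNum] using mul_bernMoment_one m i x
  | more r ih0 ih1 =>
    have hfun : (fun x => (∏ j ∈ Finset.range (r + 1), ((m : ℝ) + 4 + j)) * bernMoment m i x (r + 1))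
        = fun x => (momentNum (m + 4) i (r + 1)).eval x := funext ih1
    have hd := (hasDerivAt_bernMoment_succ m i x r).const_mul
      (∏ j ∈ Finset.range (r + 1), ((m : ℝ) + 4 + j))
    rw [hfun] at hd
    have hd' := hd.unique ((momentNum (m + 4) i (r + 1)).hasDerivAt x)
    have h := mul_bernMoment_add_two m i x r
    simp only [momentNum, eval_add, eval_mul, eval_sub, eval_C, eval_X, eval_one]
    rw [← hd', ← ih0, ← ih1, Finset.prod_range_succ _ (r + 1), Finset.prod_range_succ _ r]
    push_cast
    linear_combination (∏ j ∈ Finset.range r, ((m : ℝ) + 4 + j)) * (m + 4 + r) * h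

/-! ### The operator as a weighted sum of five averages. -/

/-- The weights of the five shifted Bernstein averages in the operator. -/
noncomputable def coeff (n x : ℝ) : Fin 5 → ℝ :=
  let β : ℝ → ℝ := fun x => n ^ 2 / 2 * x ^ 4 - (n ^ 2 + 2 * n + 2) * x ^ 3
    + (5 + 10 / 3 * n + n ^ 2 / 2) * x ^ 2 - (4 + 4 / 3 * n) * x + 1
  let γ : ℝ → ℝ := fun x => -2 * n ^ 2 * x ^ 4 + (4 * n ^ 2 + 4 * n + 4) * x ^ 3
    - (2 * n ^ 2 + 19 / 3 * n + 8) * x ^ 2 + (4 + 7 / 3 * n) * x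
  ![β x, γ x, 3 * n ^ 2 * (x * (1 - x)) ^ 2, γ (1 - x), β (1 - x)]

lemma p_sub_eq (m i k : ℕ) (x : ℝ) :
    p m ((k : ℤ) - i) x = if i ≤ k then bern m (k - i) x else 0 := by
  unfold p bern
  by_cases h : i ≤ k
  · rw [if_pos (by omega), if_pos h]
    congr 2
    omega
  · rw [if_neg (by omega), if_neg h]

lemma sum_p_sub {m i : ℕ} (hi : i ≤ 4) (L : ℕ → ℝ) (x : ℝ) :
    ∑ k ∈ Finset.range (m + 5), p m ((k : ℤ) - i) x * L k
      = ∑ k ∈ Finset.range (m + 1), bern m k x * L (k + i) := by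
  obtain ⟨j, hj⟩ := Nat.exists_eq_add_of_le hi
  have e : m + 5 = i + ((m + 1) + j) := by omega
  rw [e, Finset.sum_range_add, Finset.sum_range_add]
  have h1 : ∑ k ∈ Finset.range i, p m ((k : ℤ) - i) x * L k = 0 :=
    Finset.sum_eq_zero fun k hk => by
      rw [p_sub_eq, if_neg (by have := Finset.mem_range.mp hk; omega), zero_mul]
  have h2 : ∑ k ∈ Finset.range j, p m (((i + (m + 1 + k) : ℕ) : ℤ) - i) x * L (i + (m + 1 + k)) = 0 :=
    Finset.sum_eq_zero fun k _ => by
      rw [p_sub_eq, if_pos (by omega), Nat.add_sub_cancel_left, bern_eq,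
        Nat.choose_eq_zero_of_lt (by omega)]
      simp
  rw [h1, h2, zero_add, add_zero]
  refine Finset.sum_congr rfl fun k _ => ?_
  rw [p_sub_eq, if_pos (by omega), Nat.add_sub_cancel_left, Nat.add_comm]

lemma tildeU3_eq (m : ℕ) (f : ℝ → ℝ) (x : ℝ) :
    tildeU3 (m + 4) f x = ∑ i : Fin 5, coeff (m + 4) x i *
      ∑ k ∈ Finset.range (m + 1), bern m k x * node (m + 4) (k + i) f := by
  set n := m + 4 with hn
  have hβ : ∀ y, tildeBeta n y = coeff (m + 4) y 0 := fun y => by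
    simp [tildeBeta, coeff, hn]; ring
  have hγ : ∀ y, tildeGamma n y = coeff (m + 4) y 1 := fun y => by
    simp [tildeGamma, coeff, hn]; ring
  have hp : ∀ k : ℕ, p3 (tildeBeta n) (tildeGamma n) (tildeDelta n) n (k : ℤ) x
      = ∑ i : Fin 5, coeff (m + 4) x i * p m ((k : ℤ) - (i : ℕ)) x := by
    intro k
    have hn4 : n - 4 = m := by omega
    simp only [p3, hβ, hγ, tildeDelta, Fin.sum_univ_five, hn4]
    simp [coeff, hn]
  have hsum : ∑ i : Fin 5, coeff (m + 4) x i *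
      ∑ k ∈ Finset.range (m + 1), bern m k x * node n (k + i) f
      = ∑ k ∈ Finset.range (m + 5), p3 (tildeBeta n) (tildeGamma n) (tildeDelta n) n (k : ℤ) x
        * node n k f := by
    simp only [hp, Finset.sum_mul]
    rw [Finset.sum_comm]
    refine Finset.sum_congr rfl fun i _ => ?_
    rw [← sum_p_sub (i := (i : ℕ)) (by omega) (fun k => node n k f), Finset.mul_sum]
    simp only [mul_assoc]
  rw [hsum, tildeU3, U3, Finset.sum_range_succ, Finset.range_eq_Ico,
    Finset.sum_eq_sum_Ico_succ_bot (by omega)]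
  have h0 : node n 0 f = f 0 := by simp [node]
  have h1 : node n (m + 4) f = f 1 := by simp [node, hn]
  -- At k = 0 and k = n only one of the five terms survives, and it is the endpoint term of the
  -- operator.
  have hp0 : p3 (tildeBeta n) (tildeGamma n) (tildeDelta n) n ((0 : ℕ) : ℤ) x
      = tildeBeta n x * (1 - x) ^ (n - 4) := by
    simp [p3, p, bernsteinPolynomial]
  have hp1 : p3 (tildeBeta n) (tildeGamma n) (tildeDelta n) n ((m + 4 : ℕ) : ℤ) x
      = tildeBeta n (1 - x) * x ^ (n - 4) := by
    have e : ∀ i : ℕ, i < 4 → p m (((m + 4 : ℕ) : ℤ) - i) x = 0 := fun i hi => by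
      rw [p_sub_eq, if_pos (by omega), bern_eq, Nat.choose_eq_zero_of_lt (by omega)]; simp
    have e4 : p m (((m + 4 : ℕ) : ℤ) - (4 : ℕ)) x = x ^ m := by
      rw [p_sub_eq, if_pos (by omega), bern_eq]; simp
    have e0 := e 0 (by omega)
    have e1 := e 1 (by omega)
    have e2 := e 2 (by omega)
    have e3 := e 3 (by omega)
    simp only [Nat.cast_zero, Nat.cast_one, Nat.cast_ofNat, sub_zero] at e0 e1 e2 e3 e4
    simp only [p3, hn, Nat.add_sub_cancel, e0, e1, e2, e3, e4]
    ring
  rw [h0, h1, hp0, hp1]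
  have hmid : (↑n - 1) * ∑ k ∈ Finset.Icc 1 (n - 1),
      p3 (tildeBeta n) (tildeGamma n) (tildeDelta n) n (k : ℤ) x
        * ∫ t in (0 : ℝ)..1, p (n - 2) ((k : ℤ) - 1) t * f t
      = ∑ k ∈ Finset.Ico (0 + 1) (m + 4),
        p3 (tildeBeta n) (tildeGamma n) (tildeDelta n) n (k : ℤ) x * node n k f := by
    rw [Finset.mul_sum]
    have : Finset.Icc 1 (n - 1) = Finset.Ico (0 + 1) (m + 4) := by
      ext k; simp only [Finset.mem_Icc, Finset.mem_Ico]; omega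
    rw [this]
    refine Finset.sum_congr rfl fun k hk => ?_
    have hk' := Finset.mem_Ico.mp hk
    rw [node, if_neg (by omega), if_neg (by omega)]
    have e : ∀ t, p (n - 2) ((k : ℤ) - 1) t = bern (n - 2) (k - 1) t := fun t => by
      have := p_sub_eq (n - 2) 1 k t
      rw [if_pos (by omega)] at this
      simpa using this
    simp only [e]
    ring
  rw [hmid]
  ring

lemma tildeMu3_eq (m r : ℕ) (x : ℝ) :
    tildeMu3 (m + 4) r x = (∑ i : Fin 5, coeff (m + 4) x i *
      (momentNum (m + 4) (i : ℕ) r).eval x) / ∏ j ∈ Finset.range r, ((m : ℝ) + 4 + j) := by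
  have hpos : (∏ j ∈ Finset.range r, ((m : ℝ) + 4 + j)) ≠ 0 :=
    Finset.prod_ne_zero_iff.mpr fun j _ => by positivity
  rw [tildeMu3, tildeU3_eq, eq_div_iff hpos, Finset.sum_mul]
  refine Finset.sum_congr rfl fun i _ => ?_
  rw [← bernMoment_eq, bernMoment, mul_assoc, mul_comm (∑ k ∈ _, _)]
  congr 2
  refine Finset.sum_congr rfl fun k hk => ?_
  rw [node_sub_pow (by omega) (by have := Finset.mem_range.mp hk; omega)]
  push_cast
  rfl

/-! ### Growth of the numerators in n, and cancellation among the weights. -/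

/-- Finite sums of terms `n ^ a * i ^ b * g(x)` with `2 * a + b ≤ w`. -/
inductive WeightLE (w : ℕ) : (ℝ → ℝ → ℝ[X]) → Prop
  | monomial (g : ℝ[X]) (a b : ℕ) (h : 2 * a + b ≤ w) :
      WeightLE w (fun n i => C (n ^ a * i ^ b) * g)
  | add {F G : ℝ → ℝ → ℝ[X]} (hF : WeightLE w F) (hG : WeightLE w G) :
      WeightLE w (fun n i => F n i + G n i)

namespace WeightLE

lemma mono {v w : ℕ} (hvw : v ≤ w) {F : ℝ → ℝ → ℝ[X]} (hF : WeightLE v F) : WeightLE w F := by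
  induction hF with
  | monomial g a b h => exact monomial g a b (h.trans hvw)
  | add _ _ hF hG => exact add hF hG

lemma mul_left {w : ℕ} {F : ℝ → ℝ → ℝ[X]} (q : ℝ[X]) (hF : WeightLE w F) :
    WeightLE w (fun n i => q * F n i) := by
  induction hF with
  | monomial g a b h => simpa only [mul_left_comm q] using monomial (q * g) a b h
  | add _ _ hF hG => simpa only [mul_add] using add hF hG

lemma derivative {w : ℕ} {F : ℝ → ℝ → ℝ[X]} (hF : WeightLE w F) :
    WeightLE w (fun n i => Polynomial.derivative (F n i)) := by
  induction hF with
  | monomial g a b h =>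
    simpa only [derivative_C_mul] using monomial (Polynomial.derivative g) a b h
  | add _ _ hF hG => simpa only [derivative_add] using add hF hG

lemma C_left_mul {w : ℕ} {F : ℝ → ℝ → ℝ[X]} (hF : WeightLE w F) :
    WeightLE (w + 2) (fun n i => C n * F n i) := by
  induction hF with
  | monomial g a b h =>
    have e : ∀ n i : ℝ, C n * (C (n ^ a * i ^ b) * g) = C (n ^ (a + 1) * i ^ b) * g := by
      intro n i; rw [← mul_assoc, ← C_mul]; congr 2; ring
    simpa only [e] using monomial g (a + 1) b (by omega)
  | add _ _ hF hG => simpa only [mul_add] using add hF hG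

lemma C_right_mul {w : ℕ} {F : ℝ → ℝ → ℝ[X]} (hF : WeightLE w F) :
    WeightLE (w + 1) (fun n i => C i * F n i) := by
  induction hF with
  | monomial g a b h =>
    have e : ∀ n i : ℝ, C i * (C (n ^ a * i ^ b) * g) = C (n ^ a * i ^ (b + 1)) * g := by
      intro n i; rw [← mul_assoc, ← C_mul]; congr 2; ring
    simpa only [e] using monomial g a (b + 1) (by omega)
  | add _ _ hF hG => simpa only [mul_add] using add hF hG

/-- In the recursion a factor n (weight 2) only meets the numerator two orders down, a factor i
(weight 1) the one just below; operations in x are free. -/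
lemma momentNum (r : ℕ) : WeightLE r (fun n i => GenuineBD.momentNum n i r) := by
  have h0 : WeightLE 0 (fun n i => GenuineBD.momentNum n i 0) := by
    simpa [GenuineBD.momentNum] using monomial (w := 0) 1 0 0 le_rfl
  induction r using Nat.twoStepInduction with
  | zero => exact h0
  | one =>
    have h := add h0.C_right_mul ((h0.mul_left (-C 4 * X)).mono (Nat.zero_le 1))
    simpa [GenuineBD.momentNum, sub_eq_add_neg] using h
  | more r ih0 ih1 =>
    have h1 := (ih0.mul_left (C (2 * ((r : ℝ) + 1)) * (X * (1 - X)))).C_left_mul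
    have h2 := (ih0.mul_left (C (2 * ((r : ℝ) + 1) * r) * (X * (1 - X)))).mono
      (Nat.le_add_right r 2)
    have h3 := (ih1.mul_left (C ((r : ℝ) + 1) * (1 - C 2 * X) - C 4 * X)).mono (Nat.le_succ _)
    have h4 := (ih1.derivative.mul_left (X * (1 - X))).mono (Nat.le_succ _)
    have h := add (add (add (add h1 h2) h3) ih1.C_right_mul) h4
    convert h using 3 with n i
    simp only [GenuineBD.momentNum, C_mul, C_add]
    ring

end WeightLE

lemma exists_abs_le_of_continuousOn {g : ℝ → ℝ} (hg : ContinuousOn g (Set.Icc 0 1)) :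
    ∃ K : ℝ, 0 ≤ K ∧ ∀ x ∈ Set.Icc (0 : ℝ) 1, |g x| ≤ K := by
  obtain ⟨K, hK⟩ := isCompact_Icc.exists_bound_of_continuousOn hg
  exact ⟨K, (abs_nonneg _).trans (hK 0 (by simp)), hK⟩

lemma mem_Icc_mul_pow {c d x : ℝ} (hc : 0 ≤ c) (hcd : c ≤ d) (hx : x ∈ Set.Icc (0 : ℝ) 1) (k : ℕ) :
    c * x ^ k ∈ Set.Icc 0 d :=
  ⟨mul_nonneg hc (pow_nonneg hx.1 k),
    (mul_le_of_le_one_right hc (pow_le_one₀ hx.1 hx.2)).trans hcd⟩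

lemma abs_coeff_le {n x : ℝ} (hn : 4 ≤ n) (hx : x ∈ Set.Icc (0 : ℝ) 1) (i : Fin 5) :
    |coeff n x i| ≤ 30 * n ^ 2 := by
  have hn1 : n ≤ n ^ 2 := by nlinarith
  have h2 : ∀ y ∈ Set.Icc (0 : ℝ) 1, ∀ k, n ^ 2 * y ^ k ∈ Set.Icc 0 (n ^ 2) :=
    fun y hy => mem_Icc_mul_pow (by positivity) le_rfl hy
  have h1 : ∀ y ∈ Set.Icc (0 : ℝ) 1, ∀ k, n * y ^ k ∈ Set.Icc 0 n :=
    fun y hy => mem_Icc_mul_pow (by linarith) le_rfl hy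
  have h0 : ∀ y ∈ Set.Icc (0 : ℝ) 1, ∀ k, 1 * y ^ k ∈ Set.Icc (0 : ℝ) 1 :=
    fun y hy => mem_Icc_mul_pow zero_le_one le_rfl hy
  have hβ : ∀ y ∈ Set.Icc (0 : ℝ) 1, |n ^ 2 / 2 * y ^ 4 - (n ^ 2 + 2 * n + 2) * y ^ 3
      + (5 + 10 / 3 * n + n ^ 2 / 2) * y ^ 2 - (4 + 4 / 3 * n) * y + 1| ≤ 30 * n ^ 2 := by
    intro y hy
    have := h2 y hy 4; have := h2 y hy 3; have := h2 y hy 2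
    have := h1 y hy 3; have := h1 y hy 2; have := h1 y hy 1
    have := h0 y hy 3; have := h0 y hy 2; have := h0 y hy 1
    simp only [Set.mem_Icc] at *
    rw [abs_le]
    constructor <;> linarith
  have hγ : ∀ y ∈ Set.Icc (0 : ℝ) 1, |-2 * n ^ 2 * y ^ 4 + (4 * n ^ 2 + 4 * n + 4) * y ^ 3
      - (2 * n ^ 2 + 19 / 3 * n + 8) * y ^ 2 + (4 + 7 / 3 * n) * y| ≤ 30 * n ^ 2 := by
    intro y hy
    have := h2 y hy 4; have := h2 y hy 3; have := h2 y hy 2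
    have := h1 y hy 3; have := h1 y hy 2; have := h1 y hy 1
    have := h0 y hy 3; have := h0 y hy 2; have := h0 y hy 1
    simp only [Set.mem_Icc] at *
    rw [abs_le]
    constructor <;> linarith
  have hδ : |3 * n ^ 2 * (x * (1 - x)) ^ 2| ≤ 30 * n ^ 2 := by
    have := h2 x hx 4; have := h2 x hx 3; have := h2 x hx 2
    simp only [Set.mem_Icc] at *
    rw [abs_le]
    constructor <;> linarith
  have hx' : 1 - x ∈ Set.Icc (0 : ℝ) 1 := ⟨by linarith [hx.2], by linarith [hx.1]⟩
  fin_cases i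
  · exact hβ x hx
  · exact hγ x hx
  · exact hδ
  · exact hγ _ hx'
  · exact hβ _ hx'

/-- The n^2 part of the weights is n^2 x^2 (1-x)^2 / 2 times (1, -4, 6, -4, 1), which annihilates
i^b for b ≤ 3. The part linear in n also drops out for b = 0 and b = 1. -/
lemma sum_coeff_mul_pow_zero (n x : ℝ) :
    ∑ i : Fin 5, coeff n x i * ((i : ℕ) : ℝ) ^ 0 = 1 := by
  simp [Fin.sum_univ_five, coeff]; ring

lemma sum_coeff_mul_pow_one (n x : ℝ) :
    ∑ i : Fin 5, coeff n x i * ((i : ℕ) : ℝ) ^ 1 = 4 * x := by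
  simp [Fin.sum_univ_five, coeff]; ring

lemma sum_coeff_mul_pow_two (n x : ℝ) :
    ∑ i : Fin 5, coeff n x i * ((i : ℕ) : ℝ) ^ 2
      = 4 * x + 12 * x ^ 2 + n * (2 * x ^ 2 - 2 * x) := by
  simp [Fin.sum_univ_five, coeff]; ring

lemma sum_coeff_mul_pow_three (n x : ℝ) :
    ∑ i : Fin 5, coeff n x i * ((i : ℕ) : ℝ) ^ 3
      = 4 * x + 36 * x ^ 2 + 24 * x ^ 3 + n * (24 * x ^ 3 - 24 * x ^ 2) := by
  simp [Fin.sum_univ_five, coeff]; ring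

lemma abs_sum_coeff_mul_pow_le {n x : ℝ} (hn : 4 ≤ n) (hx : x ∈ Set.Icc (0 : ℝ) 1) (b : ℕ) :
    |∑ i : Fin 5, coeff n x i * ((i : ℕ) : ℝ) ^ b| ≤ 150 * 4 ^ b * n ^ (b / 2) := by
  have h1 : ∀ k, n * x ^ k ∈ Set.Icc 0 n := mem_Icc_mul_pow (by linarith) le_rfl hx
  have h0 : ∀ k, 1 * x ^ k ∈ Set.Icc (0 : ℝ) 1 := mem_Icc_mul_pow zero_le_one le_rfl hx
  simp only [Set.mem_Icc] at h1 h0 hx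
  match b with
  | 0 => rw [sum_coeff_mul_pow_zero]; norm_num
  | 1 =>
    rw [sum_coeff_mul_pow_one, abs_le]
    constructor <;> norm_num <;> linarith
  | 2 =>
    rw [sum_coeff_mul_pow_two, abs_le]
    have := h1 2; have := h1 1; have := h0 2; have := h0 1
    constructor <;> norm_num <;> linarith
  | 3 =>
    rw [sum_coeff_mul_pow_three, abs_le]
    have := h1 3; have := h1 2; have := h0 3; have := h0 2; have := h0 1
    constructor <;> norm_num <;> linarith
  | b + 4 =>
    refine (Finset.abs_sum_le_sum_abs _ _).trans ?_
    have hi : ∀ i ∈ Finset.univ, |coeff n x i * ((i : ℕ) : ℝ) ^ (b + 4)|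
        ≤ 30 * n ^ ((b + 4) / 2) * 4 ^ (b + 4) := by
      intro i _
      have hi : ((i : ℕ) : ℝ) ≤ 4 := by
        have : (i : ℕ) ≤ 4 := by omega
        exact_mod_cast this
      -- From exponent 4 on no cancellation is needed: the target already allows n^2.
      have hp : n ^ 2 ≤ n ^ ((b + 4) / 2) := pow_le_pow_right₀ (by linarith) (by omega)
      rw [abs_mul, abs_of_nonneg (by positivity : 0 ≤ ((i : ℕ) : ℝ) ^ (b + 4))]
      have hc := abs_coeff_le hn hx i
      gcongr
      linarith
    refine (Finset.sum_le_sum hi).trans (le_of_eq ?_)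
    simp only [Finset.sum_const, Finset.card_univ, Fintype.card_fin, nsmul_eq_mul]
    push_cast
    ring

/-- A bound for each shift i separately, needed for the Taylor remainder, where cancellation between
the weights is unavailable. -/
lemma exists_abs_momentNum_le (r : ℕ) : ∃ K : ℝ, ∀ n x : ℝ, 4 ≤ n → x ∈ Set.Icc (0 : ℝ) 1 →
    ∀ i : Fin 5, |(momentNum n ((i : ℕ) : ℝ) r).eval x| ≤ K * n ^ (r / 2) := by
  suffices h : ∀ F, WeightLE r F → ∃ K : ℝ, ∀ n x : ℝ, 4 ≤ n → x ∈ Set.Icc (0 : ℝ) 1 →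
      ∀ i : Fin 5, |(F n ((i : ℕ) : ℝ)).eval x| ≤ K * n ^ (r / 2) from h _ (.momentNum r)
  intro F hF
  induction hF with
  | monomial g a b h =>
    obtain ⟨K, hK0, hK⟩ := exists_abs_le_of_continuousOn g.continuous.continuousOn
    refine ⟨4 ^ b * K, fun n x hn hx i => ?_⟩
    have hi : ((i : ℕ) : ℝ) ≤ 4 := by
      have : (i : ℕ) ≤ 4 := by omega
      exact_mod_cast this
    rw [eval_mul, eval_C, abs_mul, abs_mul, abs_of_nonneg (by positivity : 0 ≤ n ^ a),
      abs_of_nonneg (by positivity : 0 ≤ ((i : ℕ) : ℝ) ^ b)]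
    have h1 : n ^ a ≤ n ^ (r / 2) := pow_le_pow_right₀ (by linarith) (by omega)
    have h2 : ((i : ℕ) : ℝ) ^ b ≤ 4 ^ b := by gcongr
    calc n ^ a * ((i : ℕ) : ℝ) ^ b * |g.eval x| ≤ n ^ (r / 2) * 4 ^ b * K := by
          gcongr; exact hK x hx
      _ = _ := by ring
  | @add F G _ _ hF hG =>
    obtain ⟨K, hK⟩ := hF
    obtain ⟨L, hL⟩ := hG
    refine ⟨K + L, fun n x hn hx i => ?_⟩
    rw [eval_add, add_mul]
    exact (abs_add_le _ _).trans (add_le_add (hK n x hn hx i) (hL n x hn hx i))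

lemma exists_abs_sum_coeff_le (r : ℕ) : ∃ K : ℝ, ∀ n x : ℝ, 4 ≤ n → x ∈ Set.Icc (0 : ℝ) 1 →
    |∑ i : Fin 5, coeff n x i * (momentNum n ((i : ℕ) : ℝ) r).eval x| ≤ K * n ^ (r / 2) := by
  suffices h : ∀ F, WeightLE r F → ∃ K : ℝ, ∀ n x : ℝ, 4 ≤ n → x ∈ Set.Icc (0 : ℝ) 1 →
      |∑ i : Fin 5, coeff n x i * (F n ((i : ℕ) : ℝ)).eval x| ≤ K * n ^ (r / 2) from
    h _ (.momentNum r)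
  intro F hF
  induction hF with
  | monomial g a b h =>
    obtain ⟨K, hK0, hK⟩ := exists_abs_le_of_continuousOn g.continuous.continuousOn
    refine ⟨150 * 4 ^ b * K, fun n x hn hx => ?_⟩
    have e : ∑ i : Fin 5, coeff n x i * (C (n ^ a * ((i : ℕ) : ℝ) ^ b) * g).eval x
        = n ^ a * g.eval x * ∑ i : Fin 5, coeff n x i * ((i : ℕ) : ℝ) ^ b := by
      rw [Finset.mul_sum]
      refine Finset.sum_congr rfl fun i _ => ?_
      rw [eval_mul, eval_C]; ring
    rw [e, abs_mul, abs_mul, abs_of_nonneg (by positivity : 0 ≤ n ^ a)]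
    have h1 : n ^ (a + b / 2) ≤ n ^ (r / 2) := pow_le_pow_right₀ (by linarith) (by omega)
    calc n ^ a * |g.eval x| * |∑ i : Fin 5, coeff n x i * ((i : ℕ) : ℝ) ^ b|
        ≤ n ^ a * K * (150 * 4 ^ b * n ^ (b / 2)) := by
          gcongr
          · exact hK x hx
          · exact abs_sum_coeff_mul_pow_le hn hx b
      _ = 150 * 4 ^ b * K * n ^ (a + b / 2) := by rw [pow_add]; ring
      _ ≤ _ := by gcongr
  | @add F G _ _ hF hG =>
    obtain ⟨K, hK⟩ := hF
    obtain ⟨L, hL⟩ := hG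
    refine ⟨K + L, fun n x hn hx => ?_⟩
    simp only [eval_add, mul_add, Finset.sum_add_distrib]
    rw [add_mul]
    exact (abs_add_le _ _).trans (add_le_add (hK n x hn hx) (hL n x hn hx))

/-! ### Explicit numerators through order six. -/

lemma momentNum_two (n i : ℝ) : momentNum n i 2 =
      C (i + i ^ 2)
      + C (-8 - 10 * i + 2 * n) * X
      + C (28 - 2 * n) * X ^ 2 := by
  rw [momentNum]
  simp only [momentNum]
  simp only [derivative_sub, derivative_C_mul, derivative_C, derivative_X]
  simp only [C_add, C_sub, C_mul, C_neg, C_pow, map_ofNat, map_one, map_zero, Nat.cast_zero]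
  ring

lemma momentNum_three (n i : ℝ) : momentNum n i 3 =
      C (2 * i + 3 * i ^ 2 + i ^ 3)
      + C (-24 - 42 * i - 18 * i ^ 2 + 6 * n + 6 * n * i) * X
      + C (168 + 114 * i - 42 * n - 6 * n * i) * X ^ 2
      + C (-264 + 36 * n) * X ^ 3 := by
  rw [momentNum, momentNum_two]
  simp only [momentNum]
  simp only [derivative_add, derivative_C_mul, derivative_C, derivative_X, derivative_X_pow]
  simp only [C_add, C_sub, C_mul, C_neg, C_pow, map_ofNat, map_one, Nat.cast_ofNat, Nat.cast_one]
  ring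

lemma momentNum_four (n i : ℝ) : momentNum n i 4 =
      C (6 * i + 11 * i ^ 2 + 6 * i ^ 3 + i ^ 4)
      + C (-96 - 200 * i - 132 * i ^ 2 - 28 * i ^ 3 + 24 * n + 36 * n * i + 12 * n * i ^ 2)
        * X
      + C (1008 + 1068 * i + 300 * i ^ 2 - 300 * n - 204 * n * i - 12 * n * i ^ 2 + 12 * n ^
        2) * X ^ 2
      + C (-3168 - 1512 * i + 888 * n + 168 * n * i - 24 * n ^ 2) * X ^ 3
      + C (3096 - 612 * n + 12 * n ^ 2) * X ^ 4 := by
  rw [momentNum, momentNum_three, momentNum_two]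
  simp only [derivative_add, derivative_C_mul, derivative_C, derivative_X, derivative_X_pow]
  simp only [C_add, C_sub, C_mul, C_neg, C_pow, map_ofNat, map_one, Nat.cast_ofNat]
  ring

lemma momentNum_five (n i : ℝ) : momentNum n i 5 =
      C (24 * i + 50 * i ^ 2 + 35 * i ^ 3 + 10 * i ^ 4 + i ^ 5)
      + C (-480 - 1120 * i - 920 * i ^ 2 - 320 * i ^ 3 - 40 * i ^ 4 + 120 * n + 220 * n * i
        + 120 * n * i ^ 2 + 20 * n * i ^ 3) * X
      + C (6720 + 8960 * i + 4080 * i ^ 2 + 640 * i ^ 3 - 2160 * n - 2200 * n * i - 600 * n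
        * i ^ 2 - 20 * n * i ^ 3 + 120 * n ^ 2 + 60 * n ^ 2 * i) * X ^ 2
      + C (-31680 - 24960 * i - 5280 * i ^ 2 + 10800 * n + 5880 * n * i + 480 * n * i ^ 2 -
        720 * n ^ 2 - 120 * n ^ 2 * i) * X ^ 3
      + C (61920 + 23040 * i - 19800 * n - 3900 * n * i + 1080 * n ^ 2 + 60 * n ^ 2 * i) * X
        ^ 4
      + C (-43200 + 11040 * n - 480 * n ^ 2) * X ^ 5 := by
  rw [momentNum, momentNum_four, momentNum_three]
  simp only [derivative_add, derivative_C_mul, derivative_C, derivative_X, derivative_X_pow]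
  simp only [C_add, C_sub, C_mul, C_neg, C_pow, map_ofNat, map_one, Nat.cast_ofNat]
  ring

lemma momentNum_six (n i : ℝ) : momentNum n i 6 =
      C (120 * i + 274 * i ^ 2 + 225 * i ^ 3 + 85 * i ^ 4 + 15 * i ^ 5 + i ^ 6)
      + C (-2880 - 7296 * i - 6900 * i ^ 2 - 3090 * i ^ 3 - 660 * i ^ 4 - 54 * i ^ 5 + 720 *
        n + 1500 * n * i + 1050 * n * i ^ 2 + 300 * n * i ^ 3 + 30 * n * i ^ 4) * X
      + C (50400 + 78000 * i + 45600 * i ^ 2 + 12000 * i ^ 3 + 1200 * i ^ 4 - 16920 * n -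
        21480 * n * i - 9150 * n * i ^ 2 - 1380 * n * i ^ 3 - 30 * n * i ^ 4 + 1080 * n ^ 2
        + 900 * n ^ 2 * i + 180 * n ^ 2 * i ^ 2) * X ^ 2
      + C (-316800 - 324000 * i - 115200 * i ^ 2 - 14400 * i ^ 3 + 119040 * n + 96120 * n *
        i + 22680 * n * i ^ 2 + 1080 * n * i ^ 3 - 10440 * n ^ 2 - 5040 * n ^ 2 * i - 360 *
        n ^ 2 * i ^ 2 + 120 * n ^ 3) * X ^ 3
      + C (928800 + 590400 * i + 100800 * i ^ 2 - 356040 * n - 165780 * n * i - 14580 * n *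
        i ^ 2 + 32400 * n ^ 2 + 7380 * n ^ 2 * i + 180 * n ^ 2 * i ^ 2 - 360 * n ^ 3) * X ^
        4
      + C (-1296000 - 397440 * i + 469440 * n + 89640 * n * i - 37800 * n ^ 2 - 3240 * n ^ 2
        * i + 360 * n ^ 3) * X ^ 5
      + C (696960 - 216240 * n + 14760 * n ^ 2 - 120 * n ^ 3) * X ^ 6 := by
  rw [momentNum, momentNum_five, momentNum_four]
  simp only [derivative_add, derivative_C_mul, derivative_C, derivative_X, derivative_X_pow]
  simp only [C_add, C_sub, C_mul, C_neg, C_pow, map_ofNat, map_one, Nat.cast_ofNat]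
  ring

lemma sum_coeff_mul_momentNum_one (n x : ℝ) :
    ∑ i : Fin 5, coeff n x i * (momentNum n ((i : ℕ) : ℝ) 1).eval x =
      0 := by
  simp only [momentNum, Fin.sum_univ_five, coeff, eval_sub, eval_mul, eval_C,
    eval_X]
  simp
  ring

lemma sum_coeff_mul_momentNum_two (n x : ℝ) :
    ∑ i : Fin 5, coeff n x i * (momentNum n ((i : ℕ) : ℝ) 2).eval x =
      0 := by
  simp only [momentNum_two, Fin.sum_univ_five, coeff, eval_add, eval_mul, eval_pow, eval_C,
    eval_X]
  simp
  ring

lemma sum_coeff_mul_momentNum_three (n x : ℝ) :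
    ∑ i : Fin 5, coeff n x i * (momentNum n ((i : ℕ) : ℝ) 3).eval x =
      0 := by
  simp only [momentNum_three, Fin.sum_univ_five, coeff, eval_add, eval_mul, eval_pow, eval_C,
    eval_X]
  simp
  ring

lemma sum_coeff_mul_momentNum_four (n x : ℝ) :
    ∑ i : Fin 5, coeff n x i * (momentNum n ((i : ℕ) : ℝ) 4).eval x =
      4 * x * (1 - x) * (39 * x ^ 2 - 39 * x + 10) * n - 24 * x ^ 2 * (1 - x) ^ 2 := by
  simp only [momentNum_four, Fin.sum_univ_five, coeff, eval_add, eval_mul, eval_pow, eval_C,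
    eval_X]
  simp
  ring

lemma sum_coeff_mul_momentNum_five (n x : ℝ) :
    ∑ i : Fin 5, coeff n x i * (momentNum n ((i : ℕ) : ℝ) 5).eval x =
      120 * (1 - 2 * x) * x ^ 2 * (1 - x) ^ 2 * n ^ 2
      + (680 * x - 4800 * x ^ 2 + 12400 * x ^ 3 - 13800 * x ^ 4 + 5520 * x ^ 5) * n
      + (-480 * x ^ 2 + 1920 * x ^ 3 - 2400 * x ^ 4 + 960 * x ^ 5) := by
  simp only [momentNum_five, Fin.sum_univ_five, coeff, eval_add, eval_mul, eval_pow, eval_C,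
    eval_X]
  simp
  ring

lemma sum_coeff_mul_momentNum_six (n x : ℝ) :
    ∑ i : Fin 5, coeff n x i * (momentNum n ((i : ℕ) : ℝ) 6).eval x =
      120 * x ^ 3 * (1 - x) ^ 3 * n ^ 3
      + (3720 * x ^ 2 - 22560 * x ^ 3 + 49080 * x ^ 4 - 45360 * x ^ 5 + 15120 * x ^ 6) * n ^
        2
      + (9120 * x - 83400 * x ^ 2 + 299280 * x ^ 3 - 526440 * x ^ 4 + 452160 * x ^ 5 -
        150720 * x ^ 6) * n
      + (-7200 * x ^ 2 + 43200 * x ^ 3 - 93600 * x ^ 4 + 86400 * x ^ 5 - 28800 * x ^ 6) := by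
  simp only [momentNum_six, Fin.sum_univ_five, coeff, eval_add, eval_mul, eval_pow, eval_C,
    eval_X]
  simp
  ring

/-! ### From numerators to moments. -/

lemma pow_le_prod_range_add {n : ℝ} (hn : 0 ≤ n) (r : ℕ) :
    n ^ r ≤ ∏ j ∈ Finset.range r, (n + j) := by
  have h := Finset.prod_le_prod (s := Finset.range r) (f := fun _ => n) (g := fun j : ℕ => n + j)
    (fun _ _ => hn) (fun j _ => by simp)
  simpa using h

lemma prod_range_succ_add (n : ℝ) (r : ℕ) :
    ∏ j ∈ Finset.range (r + 1), (n + j) = n * ∏ k ∈ Finset.Icc 1 r, (n + (k : ℝ)) := by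
  have : Finset.Icc 1 r = Finset.Ico (0 + 1) (r + 1) := by
    ext k; simp only [Finset.mem_Icc, Finset.mem_Ico]; omega
  rw [this, Finset.range_eq_Ico, Finset.prod_eq_prod_Ico_succ_bot (by omega)]
  simp

lemma abs_div_prod_range_add_le {n a K : ℝ} {r d e : ℕ} (hn : 0 < n) (h : d + e = r)
    (ha : |a| ≤ K * n ^ d) : |a / ∏ j ∈ Finset.range r, (n + j)| ≤ K / n ^ e := by
  have hp := pow_le_prod_range_add hn.le r
  have hn' : 0 < n ^ r := by positivity
  have hK : 0 ≤ K := nonneg_of_mul_nonneg_left ((abs_nonneg a).trans ha) (by positivity)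
  rw [abs_div, abs_of_pos (hn'.trans_le hp), div_le_div_iff₀ (hn'.trans_le hp) (by positivity)]
  calc |a| * n ^ e ≤ K * n ^ d * n ^ e := by gcongr
    _ = K * n ^ r := by rw [← h, pow_add]; ring
    _ ≤ _ := by gcongr

lemma exists_abs_tildeMu3_le (r : ℕ) : ∃ K : ℝ, ∀ n : ℕ, 4 ≤ n → ∀ x ∈ Set.Icc (0 : ℝ) 1,
    |tildeMu3 n r x| ≤ K / (n : ℝ) ^ (r - r / 2) := by
  obtain ⟨K, hK⟩ := exists_abs_sum_coeff_le r
  refine ⟨K, fun n hn x hx => ?_⟩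
  obtain ⟨m, rfl⟩ := Nat.exists_eq_add_of_le' hn
  rw [tildeMu3_eq]
  push_cast
  have hm : (4 : ℝ) ≤ m + 4 := by linarith [(Nat.cast_nonneg m : (0 : ℝ) ≤ m)]
  exact abs_div_prod_range_add_le (by linarith) (by omega) (hK _ x hm hx)

/-- A moment is close to the leading part of its numerator. -/
lemma exists_abs_tildeMu3_sub_le {r : ℕ} (d : ℕ) {e : ℕ} (he : d + e = r + 1) {F G : ℝ → ℝ → ℝ}
    (hFG : ∀ n x, ∑ i : Fin 5, coeff n x i * (momentNum n ((i : ℕ) : ℝ) (r + 1)).eval x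
      = n * F n x + G n x)
    (hG : ∃ K : ℝ, ∀ n x : ℝ, 4 ≤ n → x ∈ Set.Icc (0 : ℝ) 1 → |G n x| ≤ K * n ^ d) :
    ∃ K : ℝ, ∀ n : ℕ, 4 ≤ n → ∀ x ∈ Set.Icc (0 : ℝ) 1,
      |tildeMu3 n (r + 1) x - F n x / ∏ k ∈ Finset.Icc (1 : ℕ) r, ((n : ℝ) + (k : ℝ))|
        ≤ K / (n : ℝ) ^ e := by
  obtain ⟨K, hK⟩ := hG
  refine ⟨K, fun n hn x hx => ?_⟩
  obtain ⟨m, rfl⟩ := Nat.exists_eq_add_of_le' hn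
  have hm : (4 : ℝ) ≤ m + 4 := by linarith [(Nat.cast_nonneg m : (0 : ℝ) ≤ m)]
  have hn0 : (m : ℝ) + 4 ≠ 0 := by positivity
  rw [tildeMu3_eq, hFG]
  push_cast
  have h := abs_div_prod_range_add_le (by linarith) he (hK (m + 4) x hm hx)
  have e1 := prod_range_succ_add ((m : ℝ) + 4) r
  -- The factor n in front of F cancels the j = 0 factor of the denominator.
  rwa [add_div, e1, mul_div_mul_left _ _ hn0, add_sub_cancel_left, ← e1]

lemma exists_abs_add_mul_le {a b : ℝ → ℝ} (ha : Continuous a) (hb : Continuous b) :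
    ∃ K : ℝ, 0 ≤ K ∧ ∀ n x : ℝ, 4 ≤ n → x ∈ Set.Icc (0 : ℝ) 1 → |a x * n + b x| ≤ K * n := by
  obtain ⟨A, hA0, hA⟩ := exists_abs_le_of_continuousOn ha.continuousOn
  obtain ⟨B, hB0, hB⟩ := exists_abs_le_of_continuousOn hb.continuousOn
  refine ⟨A + B, by positivity, fun n x hn hx => (abs_add_le _ _).trans ?_⟩
  rw [abs_mul, abs_of_nonneg (by linarith : 0 ≤ n), add_mul]
  have h1 := hA x hx
  have h2 := hB x hx
  gcongr
  nlinarith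

theorem tildeMu3_one {n : ℕ} (hn : 4 ≤ n) (x : ℝ) : tildeMu3 n 1 x = 0 := by
  obtain ⟨m, rfl⟩ := Nat.exists_eq_add_of_le' hn
  rw [tildeMu3_eq, sum_coeff_mul_momentNum_one, zero_div]

theorem tildeMu3_two {n : ℕ} (hn : 4 ≤ n) (x : ℝ) : tildeMu3 n 2 x = 0 := by
  obtain ⟨m, rfl⟩ := Nat.exists_eq_add_of_le' hn
  rw [tildeMu3_eq, sum_coeff_mul_momentNum_two, zero_div]

theorem tildeMu3_three {n : ℕ} (hn : 4 ≤ n) (x : ℝ) : tildeMu3 n 3 x = 0 := by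
  obtain ⟨m, rfl⟩ := Nat.exists_eq_add_of_le' hn
  rw [tildeMu3_eq, sum_coeff_mul_momentNum_three, zero_div]

theorem exists_abs_tildeMu3_four_sub_le :
    ∃ C : ℝ, ∀ n : ℕ, 4 ≤ n → ∀ x ∈ Set.Icc (0 : ℝ) 1,
      |tildeMu3 n 4 x - 4 * x * (1 - x) * (39 * x ^ 2 - 39 * x + 10)
        / ∏ k ∈ Finset.Icc (1 : ℕ) 3, ((n : ℝ) + (k : ℝ))| ≤ C / (n : ℝ) ^ 4 := by
  refine exists_abs_tildeMu3_sub_le (r := 3) 0 (e := 4) rfl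
    (F := fun _ x => 4 * x * (1 - x) * (39 * x ^ 2 - 39 * x + 10))
    (G := fun _ x => -24 * x ^ 2 * (1 - x) ^ 2) (fun n x => ?_) ?_
  · rw [sum_coeff_mul_momentNum_four]; ring
  · obtain ⟨K, -, hK⟩ := exists_abs_le_of_continuousOn
      (g := fun x => -24 * x ^ 2 * (1 - x) ^ 2) (by fun_prop)
    exact ⟨K, fun n x _ hx => by simpa using hK x hx⟩

theorem exists_abs_tildeMu3_five_sub_le :
    ∃ C : ℝ, ∀ n : ℕ, 4 ≤ n → ∀ x ∈ Set.Icc (0 : ℝ) 1,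
      |tildeMu3 n 5 x - 120 * (1 - 2 * x) * x ^ 2 * (1 - x) ^ 2 * (n : ℝ)
        / ∏ k ∈ Finset.Icc (1 : ℕ) 4, ((n : ℝ) + (k : ℝ))| ≤ C / (n : ℝ) ^ 4 := by
  refine exists_abs_tildeMu3_sub_le (r := 4) 1 (e := 4) rfl
    (F := fun n x => 120 * (1 - 2 * x) * x ^ 2 * (1 - x) ^ 2 * n)
    (G := fun n x => (680 * x - 4800 * x ^ 2 + 12400 * x ^ 3 - 13800 * x ^ 4 + 5520 * x ^ 5) * n
      + (-480 * x ^ 2 + 1920 * x ^ 3 - 2400 * x ^ 4 + 960 * x ^ 5)) (fun n x => ?_) ?_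
  · rw [sum_coeff_mul_momentNum_five]; ring
  · obtain ⟨K, -, hK⟩ := exists_abs_add_mul_le
      (a := fun x => 680 * x - 4800 * x ^ 2 + 12400 * x ^ 3 - 13800 * x ^ 4 + 5520 * x ^ 5)
      (b := fun x => -480 * x ^ 2 + 1920 * x ^ 3 - 2400 * x ^ 4 + 960 * x ^ 5)
      (by fun_prop) (by fun_prop)
    exact ⟨K, fun n x hn hx => by simpa only [pow_one] using hK n x hn hx⟩

theorem exists_abs_tildeMu3_six_sub_le :
    ∃ C : ℝ, ∀ n : ℕ, 4 ≤ n → ∀ x ∈ Set.Icc (0 : ℝ) 1,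
      |tildeMu3 n 6 x - 120 * x ^ 3 * (1 - x) ^ 3 * (n : ℝ) ^ 2
        / ∏ k ∈ Finset.Icc (1 : ℕ) 5, ((n : ℝ) + (k : ℝ))| ≤ C / (n : ℝ) ^ 4 := by
  refine exists_abs_tildeMu3_sub_le (r := 5) 2 (e := 4) rfl
    (F := fun n x => 120 * x ^ 3 * (1 - x) ^ 3 * n ^ 2)
    (G := fun n x => (3720 * x ^ 2 - 22560 * x ^ 3 + 49080 * x ^ 4 - 45360 * x ^ 5 + 15120 * x ^ 6) * n ^ 2
      + ((9120 * x - 83400 * x ^ 2 + 299280 * x ^ 3 - 526440 * x ^ 4 + 452160 * x ^ 5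
        - 150720 * x ^ 6) * n
      + (-7200 * x ^ 2 + 43200 * x ^ 3 - 93600 * x ^ 4 + 86400 * x ^ 5 - 28800 * x ^ 6))) (fun n x => ?_) ?_
  · rw [sum_coeff_mul_momentNum_six]; ring
  · obtain ⟨K, hK0, hK⟩ := exists_abs_add_mul_le
      (a := fun x => 9120 * x - 83400 * x ^ 2 + 299280 * x ^ 3 - 526440 * x ^ 4 + 452160 * x ^ 5
        - 150720 * x ^ 6)
      (b := fun x => -7200 * x ^ 2 + 43200 * x ^ 3 - 93600 * x ^ 4 + 86400 * x ^ 5 - 28800 * x ^ 6)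
      (by fun_prop) (by fun_prop)
    obtain ⟨L, hL0, hL⟩ := exists_abs_le_of_continuousOn
      (g := fun x => 3720 * x ^ 2 - 22560 * x ^ 3 + 49080 * x ^ 4 - 45360 * x ^ 5 + 15120 * x ^ 6)
      (by fun_prop)
    refine ⟨L + K, fun n x hn hx => (abs_add_le _ _).trans ?_⟩
    rw [abs_mul, abs_of_nonneg (by positivity : 0 ≤ n ^ 2), add_mul]
    refine add_le_add (mul_le_mul_of_nonneg_right (hL x hx) (by positivity))
      ((hK n x hn hx).trans (mul_le_mul_of_nonneg_left ?_ hK0))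
    nlinarith

/-! ### Taylor expansion and the rate of approximation. -/

/-- Taylor's formula with base point anywhere in a convex set, for a chain of derivatives. -/
lemma abs_sub_sum_le_of_hasDerivWithinAt {s : Set ℝ} (hs : Convex ℝ s) {M x t : ℝ} (hx : x ∈ s)
    (ht : t ∈ s) (N : ℕ) : ∀ g : ℕ → ℝ → ℝ,
    (∀ j < N, ∀ y ∈ s, HasDerivWithinAt (g j) (g (j + 1) y) s y) → (∀ y ∈ s, |g N y| ≤ M) →
    |g 0 t - ∑ j ∈ Finset.range N, g j x / (j.factorial : ℝ) * (t - x) ^ j| ≤ M * |t - x| ^ N := by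
  induction N generalizing t with
  | zero => intro g _ hM; simpa using hM t ht
  | succ N ih =>
    intro g hg hM
    have hsub : Set.uIcc x t ⊆ s := by
      rw [← segment_eq_uIcc]; exact hs.segment_subset hx ht
    have hd : ∀ y ∈ Set.uIcc x t, HasDerivWithinAt
        (fun y => g 0 y - ∑ j ∈ Finset.range (N + 1), g j x / (j.factorial : ℝ) * (y - x) ^ j)
        (g 1 y - ∑ j ∈ Finset.range N, g (j + 1) x / (j.factorial : ℝ) * (y - x) ^ j)
        (Set.uIcc x t) y := by
      intro y hy
      have h1 := (hg 0 (Nat.succ_pos N) y (hsub hy)).mono hsub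
      have h2 : HasDerivAt
          (fun y => ∑ j ∈ Finset.range (N + 1), g j x / (j.factorial : ℝ) * (y - x) ^ j)
          (∑ j ∈ Finset.range N, g (j + 1) x / (j.factorial : ℝ) * (y - x) ^ j) y := by
        have h := HasDerivAt.fun_sum (u := Finset.range (N + 1)) fun j _ =>
          (((hasDerivAt_id y).sub_const x).fun_pow j).const_mul (g j x / (j.factorial : ℝ))
        refine h.congr_deriv ?_
        rw [Finset.sum_range_succ']
        simp only [Nat.cast_zero, zero_mul, mul_zero, add_zero]
        refine Finset.sum_congr rfl fun j _ => ?_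
        have hj : ((j.factorial : ℕ) : ℝ) ≠ 0 := by positivity
        rw [Nat.factorial_succ, Nat.add_sub_cancel]
        push_cast
        simp only [id]
        field_simp
      exact h1.sub h2.hasDerivWithinAt
    -- The derivative of the remainder is the remainder for the shifted chain, so induction bounds
    -- it on the segment; the mean value inequality then adds one factor |t-x|, without a factorial
    -- gain.
    have hbound : ∀ y ∈ Set.uIcc x t,
        ‖g 1 y - ∑ j ∈ Finset.range N, g (j + 1) x / (j.factorial : ℝ) * (y - x) ^ j‖
          ≤ M * |t - x| ^ N := by
      intro y hy
      have hM0 : 0 ≤ M := (abs_nonneg _).trans (hM x hx)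
      refine (ih (hsub hy) (fun j => g (j + 1)) (fun j hj => hg (j + 1) (by omega)) hM).trans ?_
      gcongr 1
      exact pow_le_pow_left₀ (abs_nonneg _) (Set.abs_sub_left_of_mem_uIcc hy) N
    have h := Convex.norm_image_sub_le_of_norm_hasDerivWithin_le hd hbound (convex_uIcc x t)
      Set.left_mem_uIcc Set.right_mem_uIcc
    have h0 : g 0 x - ∑ j ∈ Finset.range (N + 1), g j x / (j.factorial : ℝ) * (x - x) ^ j = 0 := by
      rw [Finset.sum_range_succ']; simp
    rw [h0, sub_zero, Real.norm_eq_abs, Real.norm_eq_abs] at h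
    rw [pow_succ, ← mul_assoc]
    exact h

lemma tildeU3_add {n : ℕ} (hn : 4 ≤ n) {f g : ℝ → ℝ} (hf : ContinuousOn f (Set.Icc 0 1))
    (hg : ContinuousOn g (Set.Icc 0 1)) (x : ℝ) :
    tildeU3 n (fun t => f t + g t) x = tildeU3 n f x + tildeU3 n g x := by
  obtain ⟨m, rfl⟩ := Nat.exists_eq_add_of_le' hn
  simp only [tildeU3_eq, node_add hf hg, mul_add, Finset.sum_add_distrib]

lemma tildeU3_const_mul {n : ℕ} (hn : 4 ≤ n) (c : ℝ) (f : ℝ → ℝ) (x : ℝ) :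
    tildeU3 n (fun t => c * f t) x = c * tildeU3 n f x := by
  obtain ⟨m, rfl⟩ := Nat.exists_eq_add_of_le' hn
  simp only [tildeU3_eq, node_const_mul, mul_left_comm _ c, ← Finset.mul_sum]

lemma tildeU3_sum_pow {n : ℕ} (hn : 4 ≤ n) (c : ℕ → ℝ) (x : ℝ) (N : ℕ) :
    tildeU3 n (fun t => ∑ j ∈ Finset.range N, c j * (t - x) ^ j) x
      = ∑ j ∈ Finset.range N, c j * tildeMu3 n j x := by
  induction N with
  | zero =>
    simpa using tildeU3_const_mul hn 0 (fun _ => 0) x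
  | succ N ih =>
    simp only [Finset.sum_range_succ]
    rw [tildeU3_add hn (Continuous.continuousOn (by fun_prop))
      (Continuous.continuousOn (by fun_prop)), ih, tildeU3_const_mul hn, tildeMu3]

lemma tildeMu3_zero {n : ℕ} (hn : 4 ≤ n) (x : ℝ) : tildeMu3 n 0 x = 1 := by
  obtain ⟨m, rfl⟩ := Nat.exists_eq_add_of_le' hn
  have h := sum_coeff_mul_pow_zero (m + 4) x
  rw [tildeMu3_eq]
  simpa [momentNum] using h

/-- The operators on functions that vanish to even order at the point of evaluation. -/
lemma exists_abs_tildeU3_le (r : ℕ) : ∃ K : ℝ, 0 ≤ K ∧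
    ∀ n : ℕ, 4 ≤ n → ∀ x ∈ Set.Icc (0 : ℝ) 1, ∀ (g : ℝ → ℝ) (M : ℝ), 0 ≤ M →
      ContinuousOn g (Set.Icc 0 1) → (∀ t ∈ Set.Icc (0 : ℝ) 1, |g t| ≤ M * (t - x) ^ (2 * (r + 2))) →
      |tildeU3 n g x| ≤ K * M / (n : ℝ) ^ r := by
  obtain ⟨K, hK⟩ := exists_abs_momentNum_le (2 * (r + 2))
  have hK0 : 0 ≤ K := nonneg_of_mul_nonneg_left
    ((abs_nonneg _).trans (hK 4 0 le_rfl (by simp) 0)) (by positivity)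
  refine ⟨150 * K, by positivity, fun n hn x hx g M hM hg hgM => ?_⟩
  obtain ⟨m, rfl⟩ := Nat.exists_eq_add_of_le' hn
  have hm : (4 : ℝ) ≤ m + 4 := by linarith [(Nat.cast_nonneg m : (0 : ℝ) ≤ m)]
  have hn0 : (0 : ℝ) < m + 4 := by positivity
  have hpow : ContinuousOn (fun t => (t - x) ^ (2 * (r + 2))) (Set.Icc (0 : ℝ) 1) :=
    Continuous.continuousOn (by fun_prop)
  -- Positivity of the functional turns the pointwise bound on g into a bound by an even central
  -- moment.
  have hnode : ∀ k ≤ m + 4,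
      |node (m + 4) k g| ≤ M * nodeMoment (m + 4) k x (2 * (r + 2)) := by
    intro k hk
    have e : M * nodeMoment (m + 4) k x (2 * (r + 2))
        = node (m + 4) k (fun t => M * (t - x) ^ (2 * (r + 2))) := by
      rw [node_const_mul, node_sub_pow (by omega) hk]; push_cast; rfl
    rw [e, abs_le, neg_eq_neg_one_mul, ← node_const_mul]
    refine ⟨node_mono (by omega) ?_ hg fun t ht => ?_,
      node_mono (by omega) hg (hpow.const_smul M) fun t ht => (abs_le.mp (hgM t ht)).2⟩
    · exact (hpow.const_smul M).const_smul (-1 : ℝ)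
    · rw [← neg_eq_neg_one_mul]; exact (abs_le.mp (hgM t ht)).1
  have hS : ∀ i : Fin 5, |∑ k ∈ Finset.range (m + 1), bern m k x * node (m + 4) (k + i) g|
      ≤ M * (K / (m + 4) ^ (r + 2)) := by
    intro i
    have h1 : |∑ k ∈ Finset.range (m + 1), bern m k x * node (m + 4) (k + i) g|
        ≤ M * bernMoment m ((i : ℕ) : ℝ) x (2 * (r + 2)) := by
      refine (Finset.abs_sum_le_sum_abs _ _).trans ?_
      rw [bernMoment, Finset.mul_sum]
      refine Finset.sum_le_sum fun k hk => ?_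
      rw [abs_mul, abs_of_nonneg (bern_nonneg m k hx), mul_left_comm]
      have := hnode (k + i) (by have := Finset.mem_range.mp hk; omega)
      push_cast at this
      exact mul_le_mul_of_nonneg_left this (bern_nonneg m k hx)
    have h2 : bernMoment m ((i : ℕ) : ℝ) x (2 * (r + 2))
        = (momentNum (m + 4) ((i : ℕ) : ℝ) (2 * (r + 2))).eval x
          / ∏ j ∈ Finset.range (2 * (r + 2)), ((m : ℝ) + 4 + j) := by
      rw [eq_div_iff (Finset.prod_ne_zero_iff.mpr fun j _ => by positivity), ← bernMoment_eq,
        mul_comm]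
    refine h1.trans (mul_le_mul_of_nonneg_left ?_ hM)
    rw [h2]
    exact (le_abs_self _).trans (abs_div_prod_range_add_le hn0 (by omega) (hK _ x hm hx i))
  rw [tildeU3_eq]
  refine (Finset.abs_sum_le_sum_abs _ _).trans ?_
  have hterm : ∀ i ∈ (Finset.univ : Finset (Fin 5)), |coeff (m + 4) x i *
      ∑ k ∈ Finset.range (m + 1), bern m k x * node (m + 4) (k + i) g|
      ≤ 30 * (m + 4) ^ 2 * (M * (K / (m + 4) ^ (r + 2))) := by
    intro i _
    rw [abs_mul]
    exact mul_le_mul (abs_coeff_le hm hx i) (hS i) (abs_nonneg _) (by positivity)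
  refine (Finset.sum_le_sum hterm).trans (le_of_eq ?_)
  simp only [Finset.sum_const, Finset.card_univ, Fintype.card_fin, nsmul_eq_mul]
  push_cast
  field_simp
  ring

/-- The general bound n^{-⌈j/2⌉} suffices from j = 5 on. At j = 4 it gives only n^{-2}, so the
explicit numerator, linear in n, is used. -/
lemma exists_abs_tildeMu3_le_pow_three {j : ℕ} (hj : 1 ≤ j) :
    ∃ K : ℝ, ∀ n : ℕ, 4 ≤ n → ∀ x ∈ Set.Icc (0 : ℝ) 1, |tildeMu3 n j x| ≤ K / (n : ℝ) ^ 3 := by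
  match j, hj with
  | 1, _ => exact ⟨0, fun n hn x _ => by simp [tildeMu3_one hn]⟩
  | 2, _ => exact ⟨0, fun n hn x _ => by simp [tildeMu3_two hn]⟩
  | 3, _ => exact ⟨0, fun n hn x _ => by simp [tildeMu3_three hn]⟩
  | 4, _ =>
    obtain ⟨K, -, hK⟩ := exists_abs_add_mul_le
      (a := fun x => 4 * x * (1 - x) * (39 * x ^ 2 - 39 * x + 10))
      (b := fun x => -24 * x ^ 2 * (1 - x) ^ 2) (by fun_prop) (by fun_prop)
    refine ⟨K, fun n hn x hx => ?_⟩
    obtain ⟨m, rfl⟩ := Nat.exists_eq_add_of_le' hn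
    have hm : (4 : ℝ) ≤ m + 4 := by linarith [(Nat.cast_nonneg m : (0 : ℝ) ≤ m)]
    rw [tildeMu3_eq, sum_coeff_mul_momentNum_four]
    push_cast
    refine abs_div_prod_range_add_le (d := 1) (by linarith) rfl ?_
    rw [pow_one]
    refine le_of_eq_of_le (congrArg _ ?_) (hK (m + 4) x hm hx)
    ring
  | j + 5, _ =>
    obtain ⟨K, hK⟩ := exists_abs_tildeMu3_le (j + 5)
    refine ⟨K, fun n hn x hx => (hK n hn x hx).trans ?_⟩
    have hn1 : (1 : ℝ) ≤ n := by exact_mod_cast (by omega : 1 ≤ n)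
    have hK0 : 0 ≤ K := by
      have h := (abs_nonneg _).trans (hK n hn x hx)
      by_contra hneg
      exact absurd h (not_le.mpr (div_neg_of_neg_of_pos (not_le.mp hneg) (by positivity)))
    have : (n : ℝ) ^ 3 ≤ (n : ℝ) ^ (j + 5 - (j + 5) / 2) := pow_le_pow_right₀ hn1 (by omega)
    gcongr

theorem exists_abs_tildeU3_sub_le {f : ℝ → ℝ} (hf : ContDiffOn ℝ 10 f (Set.Icc (0 : ℝ) 1)) :
    ∃ C : ℝ, ∀ n : ℕ, 4 ≤ n → ∀ x ∈ Set.Icc (0 : ℝ) 1,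
      |tildeU3 n f x - f x| ≤ C / (n : ℝ) ^ 3 := by
  set s := Set.Icc (0 : ℝ) 1 with hs
  have hu : UniqueDiffOn ℝ s := uniqueDiffOn_Icc zero_lt_one
  set g : ℕ → ℝ → ℝ := fun j => iteratedDerivWithin j f s with hg
  have hg0 : g 0 = f := by funext x; simp [hg]
  have hcont : ∀ j ≤ 10, ContinuousOn (g j) s := fun j hj =>
    hf.continuousOn_iteratedDerivWithin (by exact_mod_cast hj) hu
  have hder : ∀ j < 10, ∀ y ∈ s, HasDerivWithinAt (g j) (g (j + 1) y) s y := by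
    intro j hj y hy
    have h := (hf.differentiableOn_iteratedDerivWithin (m := j) (by exact_mod_cast hj) hu) y hy
    have h' := h.hasDerivWithinAt
    rwa [← iteratedDerivWithin_succ] at h'
  choose! B hB0 hB using fun (j : ℕ) (hj : j ≤ 10) => exists_abs_le_of_continuousOn (hcont j hj)
  choose! K hK using fun (j : ℕ) (hj : 1 ≤ j) => exists_abs_tildeMu3_le_pow_three hj
  -- With r = 3 the required order of vanishing is 2(3+2) = 10.
  obtain ⟨L, hL0, hL⟩ := exists_abs_tildeU3_le 3
  refine ⟨∑ j ∈ Finset.range 9, B (j + 1) * K (j + 1) + L * B 10, fun n hn x hx => ?_⟩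
  have hn0 : (0 : ℝ) < n := by exact_mod_cast (by omega : 0 < n)
  set c : ℕ → ℝ := fun j => g j x / (j.factorial : ℝ) with hc
  set P : ℝ → ℝ := fun t => ∑ j ∈ Finset.range 10, c j * (t - x) ^ j with hP
  have hPc : Continuous P := by simp only [hP]; fun_prop
  have hfc : ContinuousOn f s := hg0 ▸ hcont 0 (by norm_num)
  have hRc : ContinuousOn (fun t => f t - P t) s := hfc.sub hPc.continuousOn
  have hR := hL n hn x hx (fun t => f t - P t) (B 10) (hB0 10 le_rfl) hRc fun t ht => by
    have h := abs_sub_sum_le_of_hasDerivWithinAt (convex_Icc 0 1) hx ht 10 g hder (hB 10 le_rfl)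
    rw [hg0] at h
    rwa [(by decide : Even 10).pow_abs] at h
  have hsplit : tildeU3 n f x = tildeU3 n P x + tildeU3 n (fun t => f t - P t) x := by
    rw [← tildeU3_add hn hPc.continuousOn hRc]
    simp
  have hmain : tildeU3 n P x = f x + ∑ j ∈ Finset.range 9, c (j + 1) * tildeMu3 n (j + 1) x := by
    rw [hP, tildeU3_sum_pow hn, Finset.sum_range_succ', tildeMu3_zero hn, add_comm]
    simp [hc, hg0]
  have hsum : |∑ j ∈ Finset.range 9, c (j + 1) * tildeMu3 n (j + 1) x|
      ≤ (∑ j ∈ Finset.range 9, B (j + 1) * K (j + 1)) / (n : ℝ) ^ 3 := by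
    refine (Finset.abs_sum_le_sum_abs _ _).trans ?_
    rw [Finset.sum_div]
    refine Finset.sum_le_sum fun j hj => ?_
    have hj' := Finset.mem_range.mp hj
    rw [abs_mul, mul_div_assoc]
    have h1 : |c (j + 1)| ≤ B (j + 1) := by
      have hfac : (1 : ℝ) ≤ (j + 1).factorial := by exact_mod_cast (j + 1).factorial_pos
      rw [hc, abs_div, Nat.abs_cast]
      exact (div_le_self (abs_nonneg _) hfac).trans (hB (j + 1) (by omega) x hx)
    exact mul_le_mul h1 (hK (j + 1) (by omega) n hn x hx) (abs_nonneg _)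
      ((abs_nonneg _).trans h1)
  rw [hsplit, hmain, add_div]
  calc |f x + ∑ j ∈ Finset.range 9, c (j + 1) * tildeMu3 n (j + 1) x
        + tildeU3 n (fun t => f t - P t) x - f x|
      = |∑ j ∈ Finset.range 9, c (j + 1) * tildeMu3 n (j + 1) x
        + tildeU3 n (fun t => f t - P t) x| := by congr 1; ring
    _ ≤ _ := (abs_add_le _ _).trans (add_le_add hsum hR)

end GenuineBD

theorem mainTheorem5 :
    (∀ n : ℕ, 4 ≤ n → ∀ x ∈ Set.Icc (0 : ℝ) 1,
      GenuineBD.tildeMu3 n 1 x = 0 ∧ GenuineBD.tildeMu3 n 2 x = 0 ∧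
        GenuineBD.tildeMu3 n 3 x = 0) ∧
    (∃ C : ℝ, ∀ n : ℕ, 4 ≤ n → ∀ x ∈ Set.Icc (0 : ℝ) 1,
      |GenuineBD.tildeMu3 n 4 x
        - 4 * x * (1 - x) * (39 * x ^ 2 - 39 * x + 10)
            / ∏ k ∈ Finset.Icc (1 : ℕ) 3, ((n : ℝ) + (k : ℝ))| ≤ C / (n : ℝ) ^ 4) ∧
    (∃ C : ℝ, ∀ n : ℕ, 4 ≤ n → ∀ x ∈ Set.Icc (0 : ℝ) 1,
      |GenuineBD.tildeMu3 n 5 x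
        - 120 * (1 - 2 * x) * x ^ 2 * (1 - x) ^ 2 * (n : ℝ)
            / ∏ k ∈ Finset.Icc (1 : ℕ) 4, ((n : ℝ) + (k : ℝ))| ≤ C / (n : ℝ) ^ 4) ∧
    (∃ C : ℝ, ∀ n : ℕ, 4 ≤ n → ∀ x ∈ Set.Icc (0 : ℝ) 1,
      |GenuineBD.tildeMu3 n 6 x
        - 120 * x ^ 3 * (1 - x) ^ 3 * (n : ℝ) ^ 2
            / ∏ k ∈ Finset.Icc (1 : ℕ) 5, ((n : ℝ) + (k : ℝ))| ≤ C / (n : ℝ) ^ 4) ∧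
    (∃ C : ℝ, ∀ n : ℕ, 4 ≤ n → ∀ x ∈ Set.Icc (0 : ℝ) 1,
      |GenuineBD.tildeMu3 n 7 x| ≤ C / (n : ℝ) ^ 4 ∧
        |GenuineBD.tildeMu3 n 8 x| ≤ C / (n : ℝ) ^ 4) ∧
    (∃ C : ℝ, ∀ n : ℕ, 4 ≤ n → ∀ x ∈ Set.Icc (0 : ℝ) 1,
      |GenuineBD.tildeMu3 n 9 x| ≤ C / (n : ℝ) ^ 5 ∧
        |GenuineBD.tildeMu3 n 10 x| ≤ C / (n : ℝ) ^ 5) ∧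
    (∀ f : ℝ → ℝ, ContDiffOn ℝ 10 f (Set.Icc (0 : ℝ) 1) →
      ∃ C : ℝ, ∀ n : ℕ, 4 ≤ n → ∀ x ∈ Set.Icc (0 : ℝ) 1,
        |GenuineBD.tildeU3 n f x - f x| ≤ C / (n : ℝ) ^ 3) := by

  -- The exponents r - r/2, with integer division, are 4, 4, 5, 5.
  obtain ⟨K7, h7⟩ := GenuineBD.exists_abs_tildeMu3_le 7
  obtain ⟨K8, h8⟩ := GenuineBD.exists_abs_tildeMu3_le 8
  obtain ⟨K9, h9⟩ := GenuineBD.exists_abs_tildeMu3_le 9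
  obtain ⟨K10, h10⟩ := GenuineBD.exists_abs_tildeMu3_le 10
  refine ⟨fun n hn x _ => ⟨GenuineBD.tildeMu3_one hn x, GenuineBD.tildeMu3_two hn x,
      GenuineBD.tildeMu3_three hn x⟩,
    GenuineBD.exists_abs_tildeMu3_four_sub_le, GenuineBD.exists_abs_tildeMu3_five_sub_le,
    GenuineBD.exists_abs_tildeMu3_six_sub_le, ⟨max K7 K8, fun n hn x hx => ⟨?_, ?_⟩⟩,
    ⟨max K9 K10, fun n hn x hx => ⟨?_, ?_⟩⟩, fun f hf => GenuineBD.exists_abs_tildeU3_sub_le hf⟩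
  · exact (h7 n hn x hx).trans (div_le_div_of_nonneg_right (le_max_left _ _) (by positivity))
  · exact (h8 n hn x hx).trans (div_le_div_of_nonneg_right (le_max_right _ _) (by positivity))
  · exact (h9 n hn x hx).trans (div_le_div_of_nonneg_right (le_max_left _ _) (by positivity))
  · exact (h10 n hn x hx).trans (div_le_div_of_nonneg_right (le_max_right _ _) (by positivity))
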